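/- Let $\{(G_\lambda,S_\lambda,\star)\}_{\lambda\in\mathbb N}$ be a family of (not necessarily commutative) finite groups $G=G_\lambda$ acting on finite sets $S=S_\lambda$, with an origin $s_0=s_{0,\lambda}\in S$. Suppose that it is an effective group action (EGA): the elements of $G$ and of $S$ are represented by bit strings of length polynomial in $\lambda$, each element of $S$ having a distinguished canonical representation, and there are (classical) probabilistic polynomial-time algorithms, with negligible error, for: membership testing in $G$; equality testing in $G$; sampling from a distribution on $G$ that is statistically close to uniform; computing $gh$ and $g^{-1}$ in $G$; membership testing in $S$; computing the canonical representation of an element of $S$ from any of its representations; producing a representation of $s_0$; and computing $g\star s$ for $g\in G$, $s\in S$. Write $\approx_c$ for computational indistinguishability: for every (uniform) quantum polynomial-time algorithm that is given $1^\lambda$ and a sample (elements of $S$ being given by their canonical representations), the probabilities that it outputs $1$ on samples from the two distributions differ by a negligible function of $\lambda$. Write $x\gets X$ for independent uniform sampling. The EGA is called * pseudorandom (PR) if $\{(s_0,g\star s_0): g\gets G\}\approx_c\{(s_0,s_1): s_1\gets S\}$; * weakly pseudorandom (wPR) if for every polynomial $Q=Q(\lambda)$, $\{(s_i,g\star s_i)_{i\in[Q]}: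 g\gets G,\ s_i\gets S\}\approx_c\{(s_i,s_i')_{i\in[Q]}: s_i,s_i'\gets S\}$; * Naor–Reingold (NR) if for every polynomial $Q=Q(\lambda)$, $\{(g_i\star s_0,(\tilde g g_i)\star s_0)_{i\in[Q]}: \tilde g,g_i\gets G\}\approx_c\{(g_i\star s_0,h_i\star s_0)_{i\in[Q]}: g_i,h_i\gets G\}$. If the EGA is weakly pseudorandom and pseudorandom, then it is Naor–Reingold. -/

import Mathlib

noncomputable section

/-! ### Data -/

/-- Binary trees: the values on which algorithms work. -/
inductive BinTree : Type
  | nil : BinTree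
  | cons : BinTree → BinTree → BinTree
  deriving DecidableEq

namespace BinTree

/-- The size of a value (its number of nodes). -/
def size : BinTree → ℕ
  | nil => 1
  | cons a b => 1 + a.size + b.size

def head : BinTree → BinTree
  | nil => nil
  | cons a _ => a

def tail : BinTree → BinTree
  | nil => nil
  | cons _ b => b

def ofBool : Bool → BinTree
  | false => nil
  | true => cons nil nil

def ofList : List BinTree → BinTree
  | [] => nil
  | a :: l => cons a (ofList l)

/-- Bit strings as values. -/
def ofBits (x : List Bool) : BinTree := ofList (x.map ofBool)

/-- The value `1^n`. -/
def unary (n : ℕ) : BinTree := ofList (List.replicate n nil)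

end BinTree

/-! ### Quantum memory

There is one qubit for every label in `BinTree`. A computational basis state with finitely many
qubits equal to `1` is the finite set of the labels of those qubits. State vectors are not
normalized: a measurement projects, and its outcome probabilities are ratios of squared norms. -/

abbrev QState : Type := Finset BinTree →₀ ℂ

namespace QState

/-- All qubits are `0`. -/
def init : QState := Finsupp.single ∅ 1

/-- The Hadamard gate on qubit `i`. -/
def hadamard (i : BinTree) (ψ : QState) : QState :=
  Finsupp.linearCombination ℂ
    (fun b : Finset BinTree =>
      ((1 / Real.sqrt 2 : ℝ) : ℂ) •
        ((Finsupp.single (b.erase i) 1 : QState) +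
          Finsupp.single (insert i b) (if i ∈ b then -1 else 1))) ψ

/-- The `T` gate (phase `exp (iπ/4)` on `1`) on qubit `i`. -/
def tgate (i : BinTree) (ψ : QState) : QState :=
  Finsupp.linearCombination ℂ
    (fun b : Finset BinTree =>
      (Finsupp.single b
        (if i ∈ b then Complex.exp (Complex.I * Real.pi / 4) else 1) : QState)) ψ

/-- The controlled-not gate with control `i` and target `j`; it does nothing if `i = j`. -/
def cnot (i j : BinTree) (ψ : QState) : QState :=
  Finsupp.linearCombination ℂ
    (fun b : Finset BinTree =>
      (Finsupp.single (if i ∈ b ∧ i ≠ j then symmDiff b {j} else b) 1 : QState)) ψ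

/-- The squared norm. -/
def normSq (ψ : QState) : NNReal := ∑ b ∈ ψ.support, ‖ψ b‖₊ ^ 2

/-- The projection to the subspace in which qubit `i` has the value `v`. -/
def project (i : BinTree) (v : Bool) (ψ : QState) : QState :=
  ψ.filter (fun b => decide (i ∈ b) = v)

theorem normSq_project_le (i : BinTree) (v : Bool) (ψ : QState) :
    normSq (project i v ψ) ≤ normSq ψ := by
  unfold normSq project
  rw [Finsupp.support_filter]
  calc _ = ∑ b ∈ ψ.support.filter (fun b => decide (i ∈ b) = v), ‖ψ b‖₊ ^ 2 := by
        refine Finset.sum_congr rfl fun b hb => ?_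
        rw [Finsupp.filter_apply, if_pos (Finset.mem_filter.mp hb).2]
    _ ≤ _ := Finset.sum_le_sum_of_subset (Finset.filter_subset _ _)

end QState

/-- A random bit that is `true` with probability `p`. -/
def biasedBit (p : NNReal) (h : p ≤ 1) : PMF Bool :=
  PMF.ofFintype (fun b => ((if b then p else 1 - p : NNReal) : ENNReal)) (by
    rw [Fintype.sum_bool]
    simp only [if_true, Bool.false_eq_true, if_false]
    rw [← ENNReal.coe_add, add_tsub_cancel_of_le h, ENNReal.coe_one])

/-- The outcome of measuring qubit `i` in the computational basis. -/
def QState.measure (i : BinTree) (ψ : QState) : PMF Bool :=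
  biasedBit (QState.normSq (QState.project i true ψ) / QState.normSq ψ)
    (div_le_one_of_le₀ (QState.normSq_project_le i true ψ) (zero_le))

/-! ### Programs

A structured while-language over binary trees, with fair coins and with quantum instructions (the
universal gate set Hadamard, `T`, controlled-not, and measurements) that act on the qubits named
by the current value. Each program maps an input value to an output value and may change the
quantum memory. Programs are finite and do not depend on the security parameter, so that
polynomial time below is uniform polynomial time. -/

inductive QProg : Type
  /-- Return the input. -/
  | id : QProg
  /-- Return `nil`. -/
  | nil : QProg
  | head : QProg
  | tail : QProg
  /-- Run `p`, then `q`, on the same input, and return the pair of the two outputs. -/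
  | pair (p q : QProg) : QProg
  /-- Run `p`, then run `q` on its output. -/
  | seq (p q : QProg) : QProg
  /-- If `c` returns a value other than `nil` on the input, run `p` on it, otherwise `q`. -/
  | ite (c p q : QProg) : QProg
  /-- As long as `c` returns a value other than `nil` on the current value, replace the current
  value by the output of `p` on it. -/
  | loop (c p : QProg) : QProg
  /-- Return a fair random bit. -/
  | coin : QProg
  /-- Hadamard gate on the qubit named by the input. -/
  | hadamard : QProg
  /-- `T` gate on the qubit named by the input. -/
  | tgate : QProg
  /-- Controlled-not; the input is the pair of the names of control and target. -/
  | cnot : QProg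
  /-- Measure the qubit named by the input, and return the outcome. -/
  | measure : QProg

namespace QProg

/-- Programs without quantum instructions. -/
def IsClassical : QProg → Prop
  | id | nil | head | tail | coin => True
  | pair p q | seq p q | loop p q => p.IsClassical ∧ q.IsClassical
  | ite c p q => c.IsClassical ∧ p.IsClassical ∧ q.IsClassical
  | hadamard | tgate | cnot | measure => False

/-- The result of a run with a time budget: `none` if the budget is exceeded, otherwise the output,
the remaining budget and the quantum memory. -/
abbrev Result : Type := Option (BinTree × ℕ × QState)

/-- What runs of a program look like: input value, time budget and quantum memory are given. -/
abbrev Sem : Type := BinTree → ℕ → QState → PMF Result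

/-- Continue a computation that is still within its budget. -/
def next (m : PMF Result) (k : Sem) : PMF Result :=
  m.bind fun r =>
    match r with
    | none => PMF.pure none
    | some (y, t, ψ) => k y t ψ

/-- Executing an instruction on the value `x` takes `size x` steps. -/
def tick (k : Sem) : Sem := fun x t ψ =>
  if t < x.size then PMF.pure none else k x (t - x.size) ψ

/-- At most `N` rounds of a while loop. Every round takes at least one step, so that a number of
rounds larger than the time budget is no restriction. -/
def rounds (c p : Sem) : ℕ → Sem
  | 0 => fun _ _ _ => PMF.pure none
  | N + 1 => tick fun x t ψ =>
      next (c x t ψ) fun d t ψ =>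
        if d = BinTree.nil then PMF.pure (some (x, t, ψ))
        else next (p x t ψ) (rounds c p N)

/-- The semantics of programs. -/
def exec : QProg → Sem
  | id => tick fun x t ψ => PMF.pure (some (x, t, ψ))
  | nil => tick fun _ t ψ => PMF.pure (some (BinTree.nil, t, ψ))
  | head => tick fun x t ψ => PMF.pure (some (x.head, t, ψ))
  | tail => tick fun x t ψ => PMF.pure (some (x.tail, t, ψ))
  | pair p q => tick fun x t ψ =>
      next (p.exec x t ψ) fun y t ψ =>
        next (q.exec x t ψ) fun z t ψ => PMF.pure (some (BinTree.cons y z, t, ψ))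
  | seq p q => tick fun x t ψ => next (p.exec x t ψ) q.exec
  | ite c p q => tick fun x t ψ =>
      next (c.exec x t ψ) fun d t ψ =>
        if d = BinTree.nil then q.exec x t ψ else p.exec x t ψ
  | loop c p => fun x t ψ => rounds c.exec p.exec (t + 1) x t ψ
  | coin => tick fun _ t ψ =>
      (PMF.uniformOfFintype Bool).bind fun b => PMF.pure (some (BinTree.ofBool b, t, ψ))
  | hadamard => tick fun x t ψ => PMF.pure (some (x, t, ψ.hadamard x))
  | tgate => tick fun x t ψ => PMF.pure (some (x, t, ψ.tgate x))
  | cnot => tick fun x t ψ => PMF.pure (some (x, t, ψ.cnot x.head x.tail))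
  | measure => tick fun x t ψ =>
      (ψ.measure x).bind fun b => PMF.pure (some (BinTree.ofBool b, t, ψ.project x b))

end QProg

/-- A (uniform) quantum polynomial-time algorithm: a program which on every input, and for all
outcomes of its coins and measurements, halts within polynomially many steps in the size of the
input. -/
structure QPTAlg : Type where
  prog : QProg
  time : Polynomial ℕ
  halts : ∀ x : BinTree, none ∉ (prog.exec x (time.eval x.size) QState.init).support

/-- The distribution of the output on input `x`. -/
def QPTAlg.output (M : QPTAlg) (x : BinTree) : PMF BinTree :=
  (M.prog.exec x (M.time.eval x.size) QState.init).map fun r =>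
    match r with
    | none => BinTree.nil
    | some (y, _, _) => y

/-- The output distribution on security parameter `n` and input `x`. -/
def QPTAlg.run (M : QPTAlg) (n : ℕ) (x : BinTree) : PMF BinTree :=
  M.output (BinTree.cons (BinTree.unary n) x)

/-- The probability of an event. -/
def prob {α : Type} (p : PMF α) (E : Set α) : ℝ := (p.toOuterMeasure E).toReal

/-- Negligible functions of the security parameter. -/
def Negligible (f : ℕ → ℝ) : Prop :=
  Asymptotics.SuperpolynomialDecay Filter.atTop (fun n : ℕ => (n : ℝ)) f

/-- Two families of distributions are computationally indistinguishable with respect to quantum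
polynomial-time adversaries. -/
def CompIndist (D D' : ℕ → PMF BinTree) : Prop :=
  ∀ A : QPTAlg, Negligible fun n =>
    |prob ((D n).bind (A.run n)) {BinTree.ofBool true} -
      prob ((D' n).bind (A.run n)) {BinTree.ofBool true}|

/-- There is a (classical) probabilistic polynomial-time algorithm `M` that satisfies `spec` with
some negligible error. -/
def ExistsPPT (spec : (ℕ → BinTree → PMF BinTree) → (ℕ → ℝ) → Prop) : Prop :=
  ∃ M : QPTAlg, M.prog.IsClassical ∧ ∃ ε : ℕ → ℝ, Negligible ε ∧ spec M.run ε

/-! ### Group actions -/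

/-- A family of finite group actions with an origin, indexed by the security parameter, together
with representations of the elements by bit strings. An element may have several representations;
`canon` chooses one for each element of the set. -/
structure GroupActionFamily where
  G : ℕ → Type
  S : ℕ → Type
  [group : ∀ n, Group (G n)]
  [action : ∀ n, MulAction (G n) (S n)]
  [fintypeG : ∀ n, Fintype (G n)]
  [fintypeS : ∀ n, Fintype (S n)]
  origin : ∀ n, S n
  /-- The group element represented by a bit string, if there is one. -/
  decG : ∀ n, List Bool → Option (G n)
  /-- The set element represented by a bit string, if there is one. -/
  decS : ∀ n, List Bool → Option (S n)
  /-- The canonical representation of a set element. -/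
  canon : ∀ n, S n → List Bool
  decS_canon : ∀ n s, decS n (canon n s) = some s

namespace GroupActionFamily

attribute [instance] group action fintypeG fintypeS

instance (F : GroupActionFamily) (n : ℕ) : Nonempty (F.S n) := ⟨F.origin n⟩

open BinTree in
/-- Effective group actions: elements have representations of polynomial length, and there are
efficient algorithms for the listed tasks. -/
structure IsEffective (F : GroupActionFamily) : Prop where
  short : ∃ ℓ : Polynomial ℕ, ∀ n,
    (∀ g : F.G n, ∃ x, F.decG n x = some g ∧ x.length ≤ ℓ.eval n) ∧
    (∀ s : F.S n, (F.canon n s).length ≤ ℓ.eval n)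
  memG : ExistsPPT fun M ε => ∀ n x,
    1 - ε n ≤ prob (M n (ofBits x)) {ofBool (F.decG n x).isSome}
  eqG : ExistsPPT fun M ε => ∀ n x y g h, F.decG n x = some g → F.decG n y = some h →
    1 - ε n ≤ prob (M n (cons (ofBits x) (ofBits y))) {d | ∃ b, d = ofBool b ∧ (b = true ↔ g = h)}
  /-- The distribution of the sampled group element is statistically close to uniform. -/
  sampleG : ExistsPPT fun M ε => ∀ n (E : Set (F.G n)),
    |prob (M n nil) {d | ∃ z, d = ofBits z ∧ ∃ g ∈ E, F.decG n z = some g} -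
      prob (PMF.uniformOfFintype (F.G n)) E| ≤ ε n
  mulG : ExistsPPT fun M ε => ∀ n x y g h, F.decG n x = some g → F.decG n y = some h →
    1 - ε n ≤ prob (M n (cons (ofBits x) (ofBits y)))
      {d | ∃ z, d = ofBits z ∧ F.decG n z = some (g * h)}
  invG : ExistsPPT fun M ε => ∀ n x g, F.decG n x = some g →
    1 - ε n ≤ prob (M n (ofBits x)) {d | ∃ z, d = ofBits z ∧ F.decG n z = some g⁻¹}
  memS : ExistsPPT fun M ε => ∀ n x,
    1 - ε n ≤ prob (M n (ofBits x)) {ofBool (F.decS n x).isSome}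
  canonS : ExistsPPT fun M ε => ∀ n x s, F.decS n x = some s →
    1 - ε n ≤ prob (M n (ofBits x)) {ofBits (F.canon n s)}
  /-- The origin is publicly known. -/
  originS : ExistsPPT fun M ε => ∀ n,
    1 - ε n ≤ prob (M n nil) {d | ∃ z, d = ofBits z ∧ F.decS n z = some (F.origin n)}
  act : ExistsPPT fun M ε => ∀ n x y g s, F.decG n x = some g → F.decS n y = some s →
    1 - ε n ≤ prob (M n (cons (ofBits x) (ofBits y)))
      {d | ∃ z, d = ofBits z ∧ F.decS n z = some (g • s)}

variable (F : GroupActionFamily)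

/-- A set element as a value: its canonical representation. -/
def enc {n : ℕ} (s : F.S n) : BinTree := BinTree.ofBits (F.canon n s)

/-- A pair of set elements as a value. -/
def encPair {n : ℕ} (s t : F.S n) : BinTree := BinTree.cons (F.enc s) (F.enc t)

/-- A list of `Q` pairs of set elements as a value. -/
def encPairs {n Q : ℕ} (s t : Fin Q → F.S n) : BinTree :=
  BinTree.ofList (List.ofFn fun i => F.encPair (s i) (t i))

/-- `(s₀, g ⋆ s₀)` and `(s₀, s₁)` are indistinguishable. -/
def Pseudorandom : Prop :=
  CompIndist
    (fun n => (PMF.uniformOfFintype (F.G n)).bind fun g =>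
      PMF.pure (F.encPair (F.origin n) (g • F.origin n)))
    (fun n => (PMF.uniformOfFintype (F.S n)).bind fun s =>
      PMF.pure (F.encPair (F.origin n) s))

/-- For each polynomial `Q`, the families of `Q` pairs `(sᵢ, g ⋆ sᵢ)` and `(sᵢ, s'ᵢ)` are
indistinguishable. A uniform function on `Fin Q` is a family of independent uniform elements. -/
def WeaklyPseudorandom : Prop :=
  ∀ Q : Polynomial ℕ, CompIndist
    (fun n => (PMF.uniformOfFintype (F.G n)).bind fun g =>
      (PMF.uniformOfFintype (Fin (Q.eval n) → F.S n)).bind fun s =>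
        PMF.pure (F.encPairs s fun i => g • s i))
    (fun n => (PMF.uniformOfFintype (Fin (Q.eval n) → F.S n)).bind fun s =>
      (PMF.uniformOfFintype (Fin (Q.eval n) → F.S n)).bind fun s' =>
        PMF.pure (F.encPairs s s'))

/-- For each polynomial `Q`, the families of `Q` pairs `(gᵢ ⋆ s₀, (g̃ gᵢ) ⋆ s₀)` and
`(gᵢ ⋆ s₀, hᵢ ⋆ s₀)` are indistinguishable. -/
def NaorReingold : Prop :=
  ∀ Q : Polynomial ℕ, CompIndist
    (fun n => (PMF.uniformOfFintype (F.G n)).bind fun g' =>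
      (PMF.uniformOfFintype (Fin (Q.eval n) → F.G n)).bind fun g =>
        PMF.pure (F.encPairs (fun i => g i • F.origin n) fun i => (g' * g i) • F.origin n))
    (fun n => (PMF.uniformOfFintype (Fin (Q.eval n) → F.G n)).bind fun g =>
      (PMF.uniformOfFintype (Fin (Q.eval n) → F.G n)).bind fun h =>
        PMF.pure (F.encPairs (fun i => g i • F.origin n) fun i => h i • F.origin n))

end GroupActionFamily

end

/-! The heart is many-sample pseudorandomness of the orbit of the origin: Q independent elements gᵢ
⋆ s₀ are indistinguishable from Q independent uniform elements of S
(`orbitList_indist_uniformList`). Given this, act on every entry with a common random g̃: (gᵢ ⋆ s₀,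
g̃gᵢ ⋆ s₀) becomes (sᵢ, g̃ ⋆ sᵢ), and weak pseudorandomness leads to uniform pairs. Acting with
independent hᵢ instead, (gᵢ ⋆ s₀, hᵢgᵢ ⋆ s₀), which has the law of the second Naor–Reingold
distribution, becomes (sᵢ, hᵢ ⋆ sᵢ). This is also indistinguishable from uniform pairs: apply hᵢ to
the second components of a weak pseudorandomness sample; hᵢ absorbs the common g in one case and
permutes S in the other. Both sides meet in the uniform pairs.

The action need not be transitive, so the many-sample statement needs both hypotheses. Since hᵢ ⋆ s₀
and hᵢg ⋆ s₀ have the same law, pseudorandomness replaces the common base point s₀ by one uniform u.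
A hybrid argument then separates the base points: in the j-th hybrid, entry i is a random element of
the orbit of s_{min(i,j)}. From pairs (sᵢ, tᵢ) form hᵢ ⋆ sᵢ for i ≤ j and hᵢ ⋆ tⱼ for i > j. If tⱼ =
g ⋆ sⱼ this is hybrid j; if tⱼ is independent it is hybrid j + 1. From j = Q on the hybrids are
uniform lists. A uniform adversary must guess j; with fair coins it draws j below 2 ^ k with k =
⌈log₂ Q⌉, and telescoping costs a factor of at most 2Q + 1 (`hybridList_zero_indist_uniformList`).

The remaining work turns the reductions into programs. `Efficient` functions are closed under
composition, branching and folds, can be put in front of a quantum adversary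
(`Efficient.exists_qptAlg`), and include the group-action algorithms. Errors of these algorithms are
tracked by `ApproxCouple`, whose defects add under `bind`; `CompIndist.map` combines the two. -/

namespace PMF

theorem bind_congr_support {α β : Type*} {p : PMF α} {f g : α → PMF β}
    (h : ∀ a ∈ p.support, f a = g a) : p.bind f = p.bind g := by
  ext b
  rw [bind_apply, bind_apply]
  refine tsum_congr fun a => ?_
  by_cases ha : a ∈ p.support
  · rw [h a ha]
  · rw [(p.apply_eq_zero_iff a).2 ha, zero_mul, zero_mul]

theorem map_congr_support {α β : Type*} {p : PMF α} {f g : α → β}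
    (h : ∀ a ∈ p.support, f a = g a) : p.map f = p.map g :=
  bind_congr_support fun a ha => by simp [h a ha]

end PMF

namespace BinTree

theorem one_le_size (x : BinTree) : 1 ≤ x.size := by
  cases x <;> simp only [size] <;> omega

theorem size_head_le (x : BinTree) : x.head.size ≤ x.size := by
  cases x <;> simp only [size, head] <;> omega

theorem size_tail_le (x : BinTree) : x.tail.size ≤ x.size := by
  cases x <;> simp only [size, tail] <;> omega

theorem size_ofBool_le (b : Bool) : (ofBool b).size ≤ 3 := by
  cases b <;> simp [ofBool, size]

end BinTree

namespace QProg

/-! ### Runs with different budgets and memories -/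

/-- Common core of the two invariance arguments below: θ is either a budget shift or a replacement
of the quantum memory. Only states that `m` can reach matter. -/
theorem next_map {m : PMF Result} {k k' : Sem} (θ : BinTree × ℕ × QState → BinTree × ℕ × QState)
    (h : ∀ y t ψ, some (y, t, ψ) ∈ m.support →
      k' (θ (y, t, ψ)).1 (θ (y, t, ψ)).2.1 (θ (y, t, ψ)).2.2 = (k y t ψ).map (Option.map θ)) :
    next (m.map (Option.map θ)) k' = (next m k).map (Option.map θ) := by
  unfold next
  rw [PMF.bind_map, PMF.map_bind]
  refine PMF.bind_congr_support fun r hr => ?_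
  rcases r with _ | ⟨y, t, ψ⟩
  · simp [PMF.pure_map]
  · exact h y t ψ hr

theorem mem_support_next {m : PMF Result} {k : Sem} {r : Result} :
    r ∈ (next m k).support ↔ (none ∈ m.support ∧ r = none) ∨
      ∃ y t ψ, some (y, t, ψ) ∈ m.support ∧ r ∈ (k y t ψ).support := by
  unfold next
  rw [PMF.mem_support_bind_iff]
  constructor
  · rintro ⟨a, ha, hr⟩
    rcases a with _ | ⟨y, t, ψ⟩
    · exact Or.inl ⟨ha, by simpa using hr⟩
    · exact Or.inr ⟨y, t, ψ, ha, hr⟩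
  · rintro (⟨h, rfl⟩ | ⟨y, t, ψ, h, hr⟩)
    · exact ⟨none, h, by simp⟩
    · exact ⟨_, h, hr⟩

/-- Add `d` to the remaining budget. -/
def addBudget (d : ℕ) (r : BinTree × ℕ × QState) : BinTree × ℕ × QState := (r.1, r.2.1 + d, r.2.2)

/-- With a larger budget, runs that stay within the budget do the same. -/
def BudgetMono (d : ℕ) (k k' : Sem) : Prop := ∀ x t ψ, none ∉ (k x t ψ).support →
  k' x (t + d) ψ = (k x t ψ).map (Option.map (addBudget d))

theorem BudgetMono.next {d : ℕ} {m m' : PMF Result} {k k' : Sem}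
    (hm : none ∉ m.support → m' = m.map (Option.map (addBudget d))) (hk : BudgetMono d k k')
    (h : none ∉ (next m k).support) :
    next m' k' = (next m k).map (Option.map (addBudget d)) := by
  rw [mem_support_next, not_or] at h
  rw [hm fun hn => h.1 ⟨hn, rfl⟩]
  exact next_map _ fun y t ψ hy => hk y t ψ fun hn => h.2 ⟨y, t, ψ, hy, hn⟩

theorem BudgetMono.tick {d : ℕ} {k k' : Sem} (hk : BudgetMono d k k') :
    BudgetMono d (tick k) (tick k') := by
  intro x t ψ h
  unfold QProg.tick at h ⊢
  by_cases ht : t < x.size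
  · simp [ht] at h
  · rw [if_neg ht] at h ⊢
    rw [if_neg (by omega), ← hk x _ ψ h]
    congr 1
    omega

theorem BudgetMono.pure {d : ℕ} (f : BinTree → BinTree) (g : BinTree → QState → QState) :
    BudgetMono d (fun x t ψ => PMF.pure (some (f x, t, g x ψ)))
      (fun x t ψ => PMF.pure (some (f x, t, g x ψ))) := by
  intro x t ψ _
  simp [PMF.pure_map, addBudget]

/-- The bound on the number of rounds varies too, because a `loop` derives it from its budget. A run
that never returns `none` does not reach the bound `N`. -/
theorem BudgetMono.rounds {d : ℕ} {c p : Sem} (hc : BudgetMono d c c) (hp : BudgetMono d p p)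
    (e N : ℕ) : BudgetMono d (rounds c p N) (rounds c p (N + e)) := by
  induction N with
  | zero => intro x t ψ h; simp [QProg.rounds] at h
  | succ N ih =>
    rw [show N + 1 + e = (N + e) + 1 by omega]
    refine BudgetMono.tick fun x t ψ h => ?_
    refine BudgetMono.next (hc x t ψ) (fun y t ψ h => ?_) h
    by_cases hy : y = BinTree.nil
    · simp [hy, PMF.pure_map, addBudget]
    · simp only [if_neg hy] at h ⊢
      exact BudgetMono.next (hp x t ψ) ih h

theorem budgetMono_exec (d : ℕ) (p : QProg) : BudgetMono d p.exec p.exec := by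
  induction p with
  | id => exact (BudgetMono.pure (fun x => x) fun _ ψ => ψ).tick
  | nil => exact (BudgetMono.pure (fun _ => BinTree.nil) fun _ ψ => ψ).tick
  | head => exact (BudgetMono.pure BinTree.head fun _ ψ => ψ).tick
  | tail => exact (BudgetMono.pure BinTree.tail fun _ ψ => ψ).tick
  | pair p q hp hq =>
    refine BudgetMono.tick fun x t ψ h => ?_
    refine BudgetMono.next (hp x t ψ) (fun y t ψ h => ?_) h
    refine BudgetMono.next (hq x t ψ) (fun z t ψ h => ?_) h
    simp [PMF.pure_map, addBudget]
  | seq p q hp hq => exact BudgetMono.tick fun x t ψ h => BudgetMono.next (hp x t ψ) hq h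
  | ite c p q hc hp hq =>
    refine BudgetMono.tick fun x t ψ h => ?_
    refine BudgetMono.next (hc x t ψ) (fun y t ψ h => ?_) h
    by_cases hy : y = BinTree.nil
    · simp only [if_pos hy] at h ⊢
      exact hq x t ψ h
    · simp only [if_neg hy] at h ⊢
      exact hp x t ψ h
  | loop c p hc hp =>
    intro x t ψ h
    simp only [exec] at h ⊢
    rw [show t + d + 1 = t + 1 + d by omega]
    exact BudgetMono.rounds hc hp d (t + 1) x t ψ h
  | coin =>
    refine BudgetMono.tick fun x t ψ _ => ?_
    simp [PMF.map_bind, PMF.pure_map, addBudget]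
  | hadamard => exact (BudgetMono.pure (fun x => x) fun x ψ => ψ.hadamard x).tick
  | tgate => exact (BudgetMono.pure (fun x => x) fun x ψ => ψ.tgate x).tick
  | cnot => exact (BudgetMono.pure (fun x => x) fun x ψ => ψ.cnot x.head x.tail).tick
  | measure =>
    refine BudgetMono.tick fun x t ψ _ => ?_
    simp [PMF.map_bind, PMF.pure_map, addBudget]

/-- Replace the quantum memory. -/
def setMemory (ψ : QState) (r : BinTree × ℕ × QState) : BinTree × ℕ × QState := (r.1, r.2.1, ψ)

/-- The quantum memory is neither read nor changed. -/
def MemoryFree (k : Sem) : Prop := ∀ x t ψ ψ',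
  k x t ψ' = (k x t ψ).map (Option.map (setMemory ψ'))

theorem MemoryFree.next {m m' : PMF Result} {k : Sem} {ψ' : QState}
    (hm : m' = m.map (Option.map (setMemory ψ'))) (hk : MemoryFree k) :
    next m' k = (next m k).map (Option.map (setMemory ψ')) := by
  rw [hm]
  exact next_map _ fun y t ψ _ => hk y t ψ ψ'

theorem MemoryFree.tick {k : Sem} (hk : MemoryFree k) : MemoryFree (tick k) := by
  intro x t ψ ψ'
  unfold QProg.tick
  split_ifs
  · simp [PMF.pure_map]
  · exact hk x _ ψ ψ'

theorem MemoryFree.pure (f : BinTree → BinTree) :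
    MemoryFree (fun x t ψ => PMF.pure (some (f x, t, ψ))) := by
  intro x t ψ ψ'
  simp [PMF.pure_map, setMemory]

theorem MemoryFree.rounds {c p : Sem} (hc : MemoryFree c) (hp : MemoryFree p) (N : ℕ) :
    MemoryFree (rounds c p N) := by
  induction N with
  | zero => intro x t ψ ψ'; simp [QProg.rounds, PMF.pure_map]
  | succ N ih =>
    refine MemoryFree.tick fun x t ψ ψ' => MemoryFree.next (hc x t ψ ψ') fun y t ψ ψ' => ?_
    by_cases hy : y = BinTree.nil
    · simp [hy, PMF.pure_map, setMemory]
    · simp only [if_neg hy]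
      exact MemoryFree.next (hp x t ψ ψ') ih

theorem IsClassical.memoryFree {p : QProg} (h : p.IsClassical) : MemoryFree p.exec := by
  induction p with
  | id => exact (MemoryFree.pure (fun x => x)).tick
  | nil => exact (MemoryFree.pure (fun _ => BinTree.nil)).tick
  | head => exact (MemoryFree.pure BinTree.head).tick
  | tail => exact (MemoryFree.pure BinTree.tail).tick
  | pair p q hp hq =>
    exact MemoryFree.tick fun x t ψ ψ' => MemoryFree.next (hp h.1 x t ψ ψ') fun y t ψ ψ' =>
      MemoryFree.next (hq h.2 x t ψ ψ') fun z t ψ ψ' => by simp [PMF.pure_map, setMemory]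
  | seq p q hp hq =>
    exact MemoryFree.tick fun x t ψ ψ' => MemoryFree.next (hp h.1 x t ψ ψ') (hq h.2)
  | ite c p q hc hp hq =>
    refine MemoryFree.tick fun x t ψ ψ' => MemoryFree.next (hc h.1 x t ψ ψ') fun y t ψ ψ' => ?_
    by_cases hy : y = BinTree.nil
    · simp only [if_pos hy]
      exact hq h.2.2 x t ψ ψ'
    · simp only [if_neg hy]
      exact hp h.2.1 x t ψ ψ'
  | loop c p hc hp =>
    intro x t ψ ψ'
    exact MemoryFree.rounds (hc h.1) (hp h.2) (t + 1) x t ψ ψ'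
  | coin =>
    exact MemoryFree.tick fun x t ψ ψ' => by simp [PMF.map_bind, PMF.pure_map, setMemory]
  | hadamard | tgate | cnot | measure => exact h.elim

/-! ### The size of outputs -/

/-- Outputs are paid for by the steps used. -/
def SizeBounded (k : Sem) : Prop := ∀ x t ψ y t' ψ',
  some (y, t', ψ') ∈ (k x t ψ).support → y.size + 3 * t' ≤ 3 * t

/-- The factor 3 is the size of `ofBool true`, which a coin or a measurement can return at the cost
of one step on an input of size 1. -/
theorem sizeBounded_tick {k : Sem} (h : ∀ x t ψ y t' ψ', some (y, t', ψ') ∈ (k x t ψ).support →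
    y.size + 3 * t' ≤ 3 * t + 3 * x.size) : SizeBounded (tick k) := by
  intro x t ψ y t' ψ' hy
  unfold QProg.tick at hy
  split_ifs at hy with ht
  · simp at hy
  · have := h x _ ψ y t' ψ' hy
    omega

theorem SizeBounded.rounds {c p : Sem} (hc : SizeBounded c) (hp : SizeBounded p) (N : ℕ) :
    SizeBounded (rounds c p N) := by
  induction N with
  | zero => intro x t ψ y t' ψ' h; simp [QProg.rounds] at h
  | succ N ih =>
    refine sizeBounded_tick fun x t ψ y t' ψ' h => ?_
    simp only [mem_support_next, reduceCtorEq, and_false, false_or] at h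
    obtain ⟨d, t₁, ψ₁, hd, h⟩ := h
    have h₁ := hc _ _ _ _ _ _ hd
    split_ifs at h with hn
    · simp only [PMF.support_pure, Set.mem_singleton_iff, Option.some.injEq, Prod.mk.injEq] at h
      obtain ⟨rfl, rfl, rfl⟩ := h
      have := y.one_le_size
      omega
    · simp only [mem_support_next, reduceCtorEq, and_false, false_or] at h
      obtain ⟨z, t₂, ψ₂, hz, h⟩ := h
      have h₂ := hp _ _ _ _ _ _ hz
      have h₃ := ih _ _ _ _ _ _ h
      omega

theorem sizeBounded_exec (p : QProg) : SizeBounded p.exec := by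
  have pure {x y z : BinTree} {t t' : ℕ} {ψ ψ' : QState} (hyz : z.size ≤ 3 * x.size)
      (h : some (y, t', ψ') ∈ (PMF.pure (some (z, t, ψ)) : PMF Result).support) :
      y.size + 3 * t' ≤ 3 * t + 3 * x.size := by
    simp only [PMF.support_pure, Set.mem_singleton_iff, Option.some.injEq, Prod.mk.injEq] at h
    obtain ⟨rfl, rfl, rfl⟩ := h
    omega
  have hone := BinTree.one_le_size
  induction p with
  | id | hadamard | tgate | cnot =>
    exact sizeBounded_tick fun x t ψ y t' ψ' h => pure (by omega) h
  | nil =>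
    refine sizeBounded_tick fun x t ψ y t' ψ' h => pure ?_ h
    have := hone x
    simp only [BinTree.size]
    omega
  | head =>
    refine sizeBounded_tick fun x t ψ y t' ψ' h => pure ?_ h
    have := x.size_head_le
    omega
  | tail =>
    refine sizeBounded_tick fun x t ψ y t' ψ' h => pure ?_ h
    have := x.size_tail_le
    omega
  | coin | measure =>
    refine sizeBounded_tick fun x t ψ y t' ψ' h => ?_
    rw [PMF.mem_support_bind_iff] at h
    obtain ⟨b, _, h⟩ := h
    refine pure ?_ h
    have := hone x
    have := BinTree.size_ofBool_le b
    omega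
  | pair p q hp hq =>
    refine sizeBounded_tick fun x t ψ y t' ψ' h => ?_
    simp only [mem_support_next, reduceCtorEq, and_false, false_or] at h
    obtain ⟨a, t₁, ψ₁, ha, b, t₂, ψ₂, hb, h⟩ := h
    have h₁ := hp _ _ _ _ _ _ ha
    have h₂ := hq _ _ _ _ _ _ hb
    simp only [PMF.support_pure, Set.mem_singleton_iff, Option.some.injEq, Prod.mk.injEq] at h
    obtain ⟨rfl, rfl, rfl⟩ := h
    have := hone x
    simp only [BinTree.size]
    omega
  | seq p q hp hq =>
    refine sizeBounded_tick fun x t ψ y t' ψ' h => ?_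
    simp only [mem_support_next, reduceCtorEq, and_false, false_or] at h
    obtain ⟨a, t₁, ψ₁, ha, h⟩ := h
    have h₁ := hp _ _ _ _ _ _ ha
    have h₂ := hq _ _ _ _ _ _ h
    omega
  | ite c p q hc hp hq =>
    refine sizeBounded_tick fun x t ψ y t' ψ' h => ?_
    simp only [mem_support_next, reduceCtorEq, and_false, false_or] at h
    obtain ⟨a, t₁, ψ₁, ha, h⟩ := h
    have h₁ := hc _ _ _ _ _ _ ha
    split_ifs at h
    · have h₂ := hq _ _ _ _ _ _ h
      omega
    · have h₂ := hp _ _ _ _ _ _ h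
      omega
  | loop c p hc hp =>
    intro x t ψ
    exact SizeBounded.rounds hc hp (t + 1) x t ψ

/-! ### Halting runs -/

/-- Given at least `T` steps, the computation returns a sample from `ν` within `T` steps and leaves
the quantum memory as it is. -/
def RunsTo (k : ℕ → QState → PMF Result) (ν : PMF BinTree) (T : ℕ) : Prop :=
  ∀ t ψ, T ≤ t → ∃ μ : PMF (BinTree × ℕ), μ.map Prod.fst = ν ∧ (∀ z ∈ μ.support, t ≤ z.2 + T) ∧
    k t ψ = μ.map fun z => some (z.1, z.2, ψ)

theorem RunsTo.mono {k : ℕ → QState → PMF Result} {ν : PMF BinTree} {T T' : ℕ}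
    (h : RunsTo k ν T) (hT : T ≤ T') : RunsTo k ν T' := by
  intro t ψ ht
  obtain ⟨μ, h₁, h₂, h₃⟩ := h t ψ (hT.trans ht)
  exact ⟨μ, h₁, fun z hz => (h₂ z hz).trans (by omega), h₃⟩

theorem RunsTo.tick {k : Sem} {x : BinTree} {ν : PMF BinTree} {T : ℕ}
    (h : RunsTo (k x) ν T) : RunsTo (tick k x) ν (T + x.size) := by
  intro t ψ ht
  obtain ⟨μ, h₁, h₂, h₃⟩ := h (t - x.size) ψ (by omega)
  refine ⟨μ, h₁, fun z hz => ?_, ?_⟩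
  · have := h₂ z hz
    omega
  · rw [← h₃, QProg.tick, if_neg (by omega)]

theorem RunsTo.pure (y : BinTree) :
    RunsTo (fun t ψ => PMF.pure (some (y, t, ψ))) (PMF.pure y) 0 := by
  intro t ψ _
  exact ⟨PMF.pure (y, t), by simp [PMF.pure_map], by simp, by simp [PMF.pure_map]⟩

/-- The remaining budget is random, and may be correlated with the output; the second computation is
therefore used separately for each joint outcome. Restricting to the support of `ν` lets `T'` come
from a size bound on actual outputs. -/
theorem RunsTo.next {k : ℕ → QState → PMF Result} {k' : Sem} {ν : PMF BinTree}
    {ν' : BinTree → PMF BinTree} {T T' : ℕ} (h : RunsTo k ν T)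
    (h' : ∀ y ∈ ν.support, RunsTo (k' y) (ν' y) T') :
    RunsTo (fun t ψ => next (k t ψ) k') (ν.bind ν') (T + T') := by
  intro t ψ ht
  obtain ⟨μ, rfl, h₂, h₃⟩ := h t ψ (by omega)
  have key : ∀ z ∈ μ.support, ∃ μ' : PMF (BinTree × ℕ), μ'.map Prod.fst = ν' z.1 ∧
      (∀ w ∈ μ'.support, z.2 ≤ w.2 + T') ∧ k' z.1 z.2 ψ = μ'.map fun w => some (w.1, w.2, ψ) := by
    intro z hz
    refine h' z.1 ?_ z.2 ψ ?_
    · rw [PMF.mem_support_map_iff]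
      exact ⟨z, hz, rfl⟩
    · have := h₂ z hz
      omega
  choose! μ' hμ' using key
  refine ⟨μ.bind μ', ?_, fun w hw => ?_, ?_⟩
  · rw [PMF.map_bind, PMF.bind_map]
    exact PMF.bind_congr_support fun z hz => (hμ' z hz).1
  · rw [PMF.mem_support_bind_iff] at hw
    obtain ⟨z, hz, hw⟩ := hw
    have := h₂ z hz
    have := (hμ' z hz).2.1 w hw
    omega
  · simp only [h₃, QProg.next]
    rw [PMF.bind_map, PMF.map_bind]
    exact PMF.bind_congr_support fun z hz => (hμ' z hz).2.2

/-- Run with budget exactly `T` and apply `sizeBounded_exec`. -/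
theorem RunsTo.size_le {p : QProg} {x : BinTree} {ν : PMF BinTree} {T : ℕ}
    (h : RunsTo (p.exec x) ν T) {y : BinTree} (hy : y ∈ ν.support) : y.size ≤ 3 * T := by
  obtain ⟨μ, rfl, h₂, h₃⟩ := h T QState.init le_rfl
  rw [PMF.mem_support_map_iff] at hy
  obtain ⟨z, hz, rfl⟩ := hy
  have := sizeBounded_exec p x T QState.init z.1 z.2 QState.init (by
    rw [h₃, PMF.mem_support_map_iff]
    exact ⟨z, hz, rfl⟩)
  omega

end QProg

open QProg in
/-- A classical algorithm halts with the same output distribution for every budget that is large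
enough and every quantum memory. -/
theorem QPTAlg.runsTo (M : QPTAlg) (hM : M.prog.IsClassical) (x : BinTree) :
    RunsTo (M.prog.exec x) (M.output x) (M.time.eval x.size) := by
  intro t ψ ht
  obtain ⟨d, rfl⟩ := Nat.exists_eq_add_of_le ht
  set P := M.prog.exec x (M.time.eval x.size) QState.init with hP
  refine ⟨P.map fun r => match r with
    | none => (BinTree.nil, 0)
    | some (y, t, _) => (y, t + d), ?_, fun z hz => ?_, ?_⟩
  · rw [PMF.map_comp, QPTAlg.output, ← hP]
    refine PMF.map_congr_support fun r _ => ?_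
    rcases r with _ | ⟨y, t, ψ⟩ <;> rfl
  · rw [PMF.mem_support_map_iff] at hz
    obtain ⟨r, hr, rfl⟩ := hz
    rcases r with _ | ⟨y, t, ψ⟩
    · exact absurd hr (M.halts x)
    · simp only
      omega
  · rw [hM.memoryFree x _ QState.init ψ, budgetMono_exec d M.prog x _ QState.init (M.halts x),
      ← hP, PMF.map_comp, PMF.map_comp]
    refine PMF.map_congr_support fun r hr => ?_
    rcases r with _ | ⟨y, t, ψ⟩
    · exact absurd hr (M.halts x)
    · rfl

theorem Polynomial.eval_nat_mono (P : Polynomial ℕ) {a b : ℕ} (h : a ≤ b) :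
    P.eval a ≤ P.eval b := by
  rw [Polynomial.eval_eq_sum, Polynomial.eval_eq_sum]
  exact Finset.sum_le_sum fun i _ => Nat.mul_le_mul_left _ (Nat.pow_le_pow_left h i)

/-! ### Polynomial-time randomized functions and their closure properties -/

open QProg BinTree
open scoped ENNReal

/-- Randomized functions that are computed by a polynomial-time program which does not touch the
quantum memory. -/
def Efficient (f : BinTree → PMF BinTree) : Prop :=
  ∃ (p : QProg) (T : Polynomial ℕ), ∀ x, RunsTo (p.exec x) (f x) (T.eval x.size)

/-- Functions that are computed by a polynomial-time program. -/
def EfficientFun (g : BinTree → BinTree) : Prop := Efficient fun x => PMF.pure (g x)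

theorem QPTAlg.efficient (M : QPTAlg) (hM : M.prog.IsClassical) : Efficient M.output :=
  ⟨M.prog, M.time, M.runsTo hM⟩

theorem Efficient.size_le {f : BinTree → PMF BinTree} (hf : Efficient f) :
    ∃ P : Polynomial ℕ, ∀ x, ∀ y ∈ (f x).support, y.size ≤ P.eval x.size := by
  obtain ⟨p, T, h⟩ := hf
  refine ⟨3 * T, fun x y hy => ?_⟩
  simpa using (h x).size_le hy

theorem efficientFun_of_tick {g : BinTree → BinTree} {p : QProg}
    (h : p.exec = tick fun x t ψ => PMF.pure (some (g x, t, ψ))) : EfficientFun g := by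
  refine ⟨p, Polynomial.X, fun x => ?_⟩
  rw [h, Polynomial.eval_X]
  exact (RunsTo.tick (k := fun x t ψ => PMF.pure (some (g x, t, ψ))) (RunsTo.pure (g x))).mono
    (zero_add _).le

theorem EfficientFun.id : EfficientFun fun x => x := efficientFun_of_tick (p := .id) rfl

/-- Polynomial time composes because intermediate values have polynomial size. Correctness of `q` is
required only on values that `f` produces: the loop of a fold is understood only on well-formed loop
values. -/
theorem Efficient.bind_of_support {f g : BinTree → PMF BinTree} (hf : Efficient f) (q : QProg)
    (T : Polynomial ℕ) (hg : ∀ x, ∀ y ∈ (f x).support, RunsTo (q.exec y) (g y) (T.eval y.size)) :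
    Efficient fun x => (f x).bind g := by
  obtain ⟨P, hP⟩ := hf.size_le
  obtain ⟨p, S, hp⟩ := hf
  refine ⟨.seq p q, S + T.comp P + Polynomial.X, fun x => ?_⟩
  refine (RunsTo.tick (k := fun x t ψ => next (p.exec x t ψ) q.exec)
    ((hp x).next (T' := T.eval (P.eval x.size)) fun y hy => (hg x y hy).mono ?_)).mono ?_
  · exact T.eval_nat_mono (hP x y hy)
  · simp

theorem Efficient.bind {f g : BinTree → PMF BinTree} (hf : Efficient f) (hg : Efficient g) :
    Efficient fun x => (f x).bind g := by
  obtain ⟨q, T, hq⟩ := hg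
  exact hf.bind_of_support q T fun _ y _ => hq y

theorem Efficient.comp {f : BinTree → PMF BinTree} {g : BinTree → BinTree} (hf : Efficient f)
    (hg : EfficientFun g) : Efficient fun x => f (g x) := by
  simpa using Efficient.bind hg hf

theorem EfficientFun.comp {f g : BinTree → BinTree} (hf : EfficientFun f)
    (hg : EfficientFun g) : EfficientFun fun x => f (g x) :=
  Efficient.comp (f := fun x => PMF.pure (f x)) hf hg

theorem EfficientFun.nil : EfficientFun fun _ => BinTree.nil :=
  efficientFun_of_tick (p := .nil) rfl

theorem EfficientFun.head {g : BinTree → BinTree} (hg : EfficientFun g) :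
    EfficientFun fun x => (g x).head :=
  EfficientFun.comp (efficientFun_of_tick (p := .head) rfl) hg

theorem EfficientFun.tail {g : BinTree → BinTree} (hg : EfficientFun g) :
    EfficientFun fun x => (g x).tail :=
  EfficientFun.comp (efficientFun_of_tick (p := .tail) rfl) hg

theorem Efficient.cons {f g : BinTree → PMF BinTree} (hf : Efficient f) (hg : Efficient g) :
    Efficient fun x => (f x).bind fun y => (g x).bind fun z => PMF.pure (BinTree.cons y z) := by
  obtain ⟨p, S, hp⟩ := hf
  obtain ⟨q, T, hq⟩ := hg
  refine ⟨.pair p q, S + (T + 0) + Polynomial.X, fun x => ?_⟩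
  refine (RunsTo.tick (k := fun x t ψ => next (p.exec x t ψ) fun y t ψ =>
    next (q.exec x t ψ) fun z t ψ => PMF.pure (some (BinTree.cons y z, t, ψ)))
    ((hp x).next (k' := fun y t ψ =>
      next (q.exec x t ψ) fun z t ψ => PMF.pure (some (BinTree.cons y z, t, ψ)))
      fun y _ => (hq x).next (k' := fun z t ψ => PMF.pure (some (BinTree.cons y z, t, ψ)))
      fun z _ => RunsTo.pure (BinTree.cons y z))).mono ?_
  simp

theorem EfficientFun.cons {f g : BinTree → BinTree} (hf : EfficientFun f) (hg : EfficientFun g) :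
    EfficientFun fun x => BinTree.cons (f x) (g x) := by
  simpa [EfficientFun] using Efficient.cons hf hg

/-- Sequential composition, where the second algorithm is also given the input of the first. -/
theorem Efficient.bind_cons {f g : BinTree → PMF BinTree} (hf : Efficient f) (hg : Efficient g) :
    Efficient fun x => (f x).bind fun y => g (BinTree.cons x y) := by
  simpa using (Efficient.cons EfficientFun.id hf).bind hg

theorem Efficient.ite {c : BinTree → BinTree} {f g : BinTree → PMF BinTree} (hc : EfficientFun c)
    (hf : Efficient f) (hg : Efficient g) :
    Efficient fun x => if c x = BinTree.nil then f x else g x := by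
  obtain ⟨c', R, hc⟩ := hc
  obtain ⟨p, S, hp⟩ := hf
  obtain ⟨q, T, hq⟩ := hg
  refine ⟨.ite c' q p, R + (S + T) + Polynomial.X, fun x => ?_⟩
  have h := RunsTo.tick (k := fun x t ψ => next (c'.exec x t ψ) fun d t ψ =>
    if d = BinTree.nil then p.exec x t ψ else q.exec x t ψ)
    ((hc x).next (k' := fun d t ψ => if d = BinTree.nil then p.exec x t ψ else q.exec x t ψ)
      (ν' := fun d => if d = BinTree.nil then f x else g x) (T' := (S + T).eval x.size)
      fun d _ => ?_)
  · rw [PMF.pure_bind] at h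
    exact h.mono (by simp)
  · by_cases hd : d = BinTree.nil
    · simp only [hd, if_true]
      exact (hp x).mono (by simp)
    · simp only [hd, if_false]
      exact (hq x).mono (by simp)

theorem EfficientFun.ite {c f g : BinTree → BinTree} (hc : EfficientFun c)
    (hf : EfficientFun f) (hg : EfficientFun g) :
    EfficientFun fun x => if c x = BinTree.nil then f x else g x := by
  have h := Efficient.ite hc hf hg
  simp only [← apply_ite PMF.pure] at h
  exact h

/-- A fair coin as a value. -/
noncomputable def coinFlip : PMF BinTree :=
  (PMF.uniformOfFintype Bool).bind fun b => PMF.pure (BinTree.ofBool b)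

theorem Efficient.coin : Efficient fun _ => coinFlip := by
  refine ⟨.coin, 0 + Polynomial.X, fun x => ?_⟩
  rw [Polynomial.eval_add, Polynomial.eval_X]
  refine RunsTo.tick (k := fun _ t ψ =>
    (PMF.uniformOfFintype Bool).bind fun b => PMF.pure (some (BinTree.ofBool b, t, ψ))) ?_
  intro t ψ _
  refine ⟨(PMF.uniformOfFintype Bool).map fun b => (BinTree.ofBool b, t), ?_, fun z hz => ?_, ?_⟩
  · rw [PMF.map_comp]
    rfl
  · rw [PMF.mem_support_map_iff] at hz
    obtain ⟨b, _, rfl⟩ := hz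
    simp
  · rw [PMF.map_comp]
    rfl

/-! ### Folds -/

namespace BinTree

/-- Left fold over a value, which is read as a list; `p` is a fixed parameter. -/
noncomputable def foldlM (step : BinTree → BinTree → BinTree → PMF BinTree) (p : BinTree) :
    BinTree → BinTree → PMF BinTree
  | nil, s => PMF.pure s
  | cons a l, s => (step p a s).bind fun s => foldlM step p l s

/-- Right fold over a value, which is read as a list. -/
noncomputable def foldrM (step : BinTree → BinTree → BinTree → PMF BinTree) (p : BinTree) :
    BinTree → BinTree → PMF BinTree
  | nil, s => PMF.pure s
  | cons a l, s => (foldrM step p l s).bind fun s => step p a s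

/-- Right fold over a value, which is read as a list. -/
def foldr (step : BinTree → BinTree → BinTree → BinTree) (p : BinTree) :
    BinTree → BinTree → BinTree
  | nil, s => s
  | cons a l, s => step p a (foldr step p l s)

def reverseAppend : BinTree → BinTree → BinTree
  | nil, m => m
  | cons a l, m => reverseAppend l (cons a m)

/-- A loop consumes a list from the left, so a right fold is implemented as a left fold over the
reversed list. -/
theorem foldlM_reverseAppend (step : BinTree → BinTree → BinTree → PMF BinTree) (p s : BinTree)
    (l : BinTree) : ∀ m, foldlM step p (reverseAppend l m) s =
      (foldrM step p l s).bind fun s => foldlM step p m s := by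
  induction l with
  | nil => intro m; simp [reverseAppend, foldrM]
  | cons a l _ ih => intro m; simp [reverseAppend, foldrM, ih, foldlM]

/-- Reversal is itself a left fold, hence available as a loop. -/
theorem foldlM_cons (p l : BinTree) :
    ∀ m, foldlM (fun _ a s => PMF.pure (cons a s)) p l m = PMF.pure (reverseAppend l m) := by
  induction l with
  | nil => intro m; simp [reverseAppend, foldlM]
  | cons a l _ ih => intro m; simp [reverseAppend, foldlM, ih]

theorem foldrM_pure (step : BinTree → BinTree → BinTree → BinTree) (p l s : BinTree) :
    foldrM (fun p a s => PMF.pure (step p a s)) p l s = PMF.pure (foldr step p l s) := by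
  induction l with
  | nil => rfl
  | cons a l _ ih => simp [foldrM, foldr, ih]

end BinTree

/-- The state of a fold grows by at most a polynomial amount in every step. -/
def GrowthBounded (step : BinTree → BinTree → BinTree → PMF BinTree) : Prop :=
  ∃ K : Polynomial ℕ, ∀ p a s, ∀ y ∈ (step p a s).support,
    y.size ≤ s.size + K.eval (p.size + a.size)

/-- A loop that performs a left fold. -/
theorem runsTo_rounds_foldlM {step : BinTree → BinTree → BinTree → PMF BinTree} {c b : QProg}
    {C B : Polynomial ℕ} (hc : ∀ x, RunsTo (c.exec x) (PMF.pure x.head) (C.eval x.size))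
    (hb : ∀ x, RunsTo (b.exec x) ((step x.tail.head x.head.head x.tail.tail).bind fun s =>
      PMF.pure (.cons x.head.tail (.cons x.tail.head s))) (B.eval x.size))
    (p : BinTree) (A K M : ℕ)
    (hK : ∀ a s, a.size ≤ A → ∀ y ∈ (step p a s).support, y.size ≤ s.size + K) (l : BinTree) :
    ∀ s N, l.size ≤ A → (BinTree.cons l (.cons p s)).size + l.size * K ≤ M → l.size < N →
      RunsTo (rounds c.exec b.exec N (.cons l (.cons p s)))
        ((foldlM step p l s).bind fun s => PMF.pure (.cons .nil (.cons p s)))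
        (l.size * (M + C.eval M + B.eval M)) := by
  -- The loop value holds the remaining list, the parameter and the fold state. Its size plus
  -- `l.size * K` stays at most `M`: each removed entry releases at least `K`, which pays for the
  -- growth of the state. So `M` bounds the input of every round.
  induction l with
  | nil =>
    intro s N hA hM hN
    obtain ⟨N, rfl⟩ := Nat.exists_eq_succ_of_ne_zero (Nat.ne_zero_of_lt hN)
    set x : BinTree := .cons .nil (.cons p s) with hx
    have hxM : x.size ≤ M := by omega
    refine (RunsTo.tick (k := fun x t ψ => next (c.exec x t ψ) fun d t ψ =>
      if d = BinTree.nil then PMF.pure (some (x, t, ψ))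
      else next (b.exec x t ψ) (rounds c.exec b.exec N)) (T := C.eval M + 0) ?_).mono ?_
    · have h := ((hc x).mono (C.eval_nat_mono hxM)).next (k' := fun d t ψ =>
        if d = BinTree.nil then PMF.pure (some (x, t, ψ))
        else next (b.exec x t ψ) (rounds c.exec b.exec N)) (ν' := fun _ => PMF.pure x) (T' := 0)
        fun y hy => by
          simp only [PMF.support_pure, Set.mem_singleton_iff, hx, BinTree.head] at hy
          simp only [hy, if_true]
          exact RunsTo.pure x
      simpa [foldlM, hx] using h
    · simp only [BinTree.size, one_mul, add_zero]
      omega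
  | cons a l _ ih =>
    intro s N hA hM hN
    obtain ⟨N, rfl⟩ := Nat.exists_eq_succ_of_ne_zero (Nat.ne_zero_of_lt hN)
    set x : BinTree := .cons (.cons a l) (.cons p s) with hx
    have hxM : x.size ≤ M := by
      have : x.size + (BinTree.cons a l).size * K ≤ M := hM
      omega
    have h1 := a.one_le_size
    have hmul : l.size * K + K ≤ (BinTree.cons a l).size * K := by
      rw [← Nat.succ_mul]
      exact Nat.mul_le_mul_right _ (by simp only [BinTree.size]; omega)
    refine (RunsTo.tick (k := fun x t ψ => next (c.exec x t ψ) fun d t ψ =>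
      if d = BinTree.nil then PMF.pure (some (x, t, ψ))
      else next (b.exec x t ψ) (rounds c.exec b.exec N))
      (T := C.eval M + (B.eval M + l.size * (M + C.eval M + B.eval M))) ?_).mono ?_
    · have h := ((hc x).mono (C.eval_nat_mono hxM)).next (k' := fun d t ψ =>
        if d = BinTree.nil then PMF.pure (some (x, t, ψ))
        else next (b.exec x t ψ) (rounds c.exec b.exec N))
        (ν' := fun _ => (foldlM step p (.cons a l) s).bind fun s =>
          PMF.pure (.cons .nil (.cons p s)))
        (T' := B.eval M + l.size * (M + C.eval M + B.eval M)) fun y hy => ?_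
      · simpa using h
      simp only [PMF.support_pure, Set.mem_singleton_iff, hx, BinTree.head] at hy
      simp only [hy, reduceCtorEq, if_false]
      have h := ((hb x).mono (B.eval_nat_mono hxM)).next (k' := rounds c.exec b.exec N)
        (ν' := fun y => (foldlM step p y.head y.tail.tail).bind fun s =>
          PMF.pure (.cons .nil (.cons p s)))
        (T' := l.size * (M + C.eval M + B.eval M)) fun y hy => ?_
      · simpa [hx, foldlM, BinTree.head, BinTree.tail] using h
      · rw [PMF.mem_support_bind_iff] at hy
        obtain ⟨s', hs', hy⟩ := hy
        simp only [PMF.support_pure, Set.mem_singleton_iff, hx, BinTree.head,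
          BinTree.tail] at hy hs'
        rw [hy]
        simp only [hx, BinTree.size] at hA hM hN
        have := hK a s (by omega) s' hs'
        refine ih s' N (by omega) ?_ (by omega)
        simp only [BinTree.size] at hmul ⊢
        omega
    · have : (l.size + 1) * (M + C.eval M + B.eval M) ≤
          (BinTree.cons a l).size * (M + C.eval M + B.eval M) :=
        Nat.mul_le_mul_right _ (by simp only [BinTree.size]; omega)
      rw [Nat.succ_mul] at this
      omega

theorem Efficient.foldlM {step : BinTree → BinTree → BinTree → PMF BinTree}
    (hs : Efficient fun x => step x.head x.tail.head x.tail.tail) (hK : GrowthBounded step)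
    {fp fl fs : BinTree → BinTree} (hp : EfficientFun fp) (hl : EfficientFun fl)
    (hfs : EfficientFun fs) : Efficient fun x => BinTree.foldlM step (fp x) (fl x) (fs x) := by
  obtain ⟨K, hK⟩ := hK
  obtain ⟨c, C, hc⟩ := EfficientFun.id.head
  have body : Efficient fun x => (step x.tail.head x.head.head x.tail.tail).bind fun s =>
      PMF.pure (.cons x.head.tail (.cons x.tail.head s)) := by
    have h₁ : Efficient fun x => step x.tail.head x.head.head x.tail.tail :=
      hs.comp (g := fun x => .cons x.tail.head (.cons x.head.head x.tail.tail))
        (.cons (.head (.tail .id)) (.cons (.head (.head .id)) (.tail (.tail .id))))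
    have h₂ : EfficientFun fun x =>
        .cons x.head.head.tail (.cons x.head.tail.head x.tail) :=
      .cons (.tail (.head (.head .id))) (.cons (.head (.tail (.head .id))) (.tail .id))
    exact h₁.bind_cons h₂
  obtain ⟨b, B, hb⟩ := body
  have hloop : Efficient fun x => (PMF.pure (BinTree.cons (fl x) (.cons (fp x) (fs x)))).bind
      fun y => (BinTree.foldlM step y.tail.head y.head y.tail.tail).bind fun s =>
        PMF.pure (.cons .nil (.cons y.tail.head s)) := by
    -- Starting from size S there are at most S entries, each adding at most K(S): additive growth
    -- keeps the loop value polynomial.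
    let M : Polynomial ℕ := Polynomial.X + Polynomial.X * K
    refine Efficient.bind_of_support (EfficientFun.cons hl (.cons hp hfs)) (.loop c b)
      (Polynomial.X * (M + C.comp M + B.comp M)) fun x y hy t ψ ht => ?_
    simp only [PMF.support_pure, Set.mem_singleton_iff] at hy
    generalize fl x = l, fp x = p, fs x = s at hy
    subst hy
    set S := (BinTree.cons l (.cons p s)).size with hS
    simp only [Polynomial.eval_mul, Polynomial.eval_add, Polynomial.eval_X,
      Polynomial.eval_comp, M] at ht ⊢
    have hlS : l.size ≤ S := by simp only [hS, BinTree.size]; omega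
    set E := S + S * K.eval S + C.eval (S + S * K.eval S) + B.eval (S + S * K.eval S) with hE
    have hES : S ≤ E := by omega
    have hS1 : 1 ≤ S := BinTree.one_le_size _
    have hSE : l.size * E ≤ S * E := Nat.mul_le_mul_right _ hlS
    -- With budget t the loop is cut off after t + 1 rounds, so the time bound must also dominate
    -- the number of rounds.
    have hlE : l.size ≤ S * E := hlS.trans (hES.trans (Nat.le_mul_of_pos_left _ hS1))
    refine ((runsTo_rounds_foldlM hc hb p l.size (K.eval S) (S + S * K.eval S)
      (fun a s' ha y hy => (hK p a s' y hy).trans ?_) l s (t + 1) le_rfl ?_ ?_).mono hSE) t ψ ht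
    · exact Nat.add_le_add_left (K.eval_nat_mono (by simp only [hS, BinTree.size]; omega)) _
    · exact Nat.add_le_add_left (Nat.mul_le_mul_right _ hlS) _
    · omega
  simpa [BinTree.head, BinTree.tail] using hloop.bind (EfficientFun.tail (.tail .id))

theorem EfficientFun.reverseAppend {fl fs : BinTree → BinTree} (hl : EfficientFun fl)
    (hfs : EfficientFun fs) : EfficientFun fun x => BinTree.reverseAppend (fl x) (fs x) := by
  have hs : EfficientFun fun x => BinTree.cons x.tail.head x.tail.tail :=
    .cons (.head (.tail .id)) (.tail (.tail .id))
  have := Efficient.foldlM (step := fun _ a s => PMF.pure (.cons a s)) hs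
    ⟨1 + Polynomial.X, fun p a s y hy => by
      simp only [PMF.support_pure, Set.mem_singleton_iff] at hy
      simp only [hy, BinTree.size, Polynomial.eval_add, Polynomial.eval_one, Polynomial.eval_X]
      omega⟩ EfficientFun.nil hl hfs
  simpa only [EfficientFun, BinTree.foldlM_cons] using this

theorem Efficient.foldrM {step : BinTree → BinTree → BinTree → PMF BinTree}
    (hs : Efficient fun x => step x.head x.tail.head x.tail.tail) (hK : GrowthBounded step)
    {fp fl fs : BinTree → BinTree} (hp : EfficientFun fp) (hl : EfficientFun fl)
    (hfs : EfficientFun fs) : Efficient fun x => BinTree.foldrM step (fp x) (fl x) (fs x) := by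
  have := Efficient.foldlM hs hK hp (hl.reverseAppend .nil) hfs
  simpa [BinTree.foldlM_reverseAppend, BinTree.foldlM] using this

theorem EfficientFun.foldr {step : BinTree → BinTree → BinTree → BinTree}
    (hs : EfficientFun fun x => step x.head x.tail.head x.tail.tail) (K : Polynomial ℕ)
    (hK : ∀ p a s, (step p a s).size ≤ s.size + K.eval (p.size + a.size))
    {fp fl fs : BinTree → BinTree} (hp : EfficientFun fp) (hl : EfficientFun fl)
    (hfs : EfficientFun fs) : EfficientFun fun x => BinTree.foldr step (fp x) (fl x) (fs x) := by
  have := Efficient.foldrM (step := fun p a s => PMF.pure (step p a s)) hs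
    ⟨K, fun p a s y hy => by
      simp only [PMF.support_pure, Set.mem_singleton_iff] at hy
      exact hy ▸ hK p a s⟩ hp hl hfs
  simpa only [EfficientFun, BinTree.foldrM_pure] using this

/-- Apply a randomized function with a fixed parameter to all entries of a list. -/
noncomputable def BinTree.mapM (f : BinTree → PMF BinTree) (p l : BinTree) : PMF BinTree :=
  foldrM (fun p a s => (f (cons p a)).bind fun y => PMF.pure (cons y s)) p l nil

theorem Efficient.mapM {f : BinTree → PMF BinTree} (hf : Efficient f) {fp fl : BinTree → BinTree}
    (hp : EfficientFun fp) (hl : EfficientFun fl) :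
    Efficient fun x => BinTree.mapM f (fp x) (fl x) := by
  obtain ⟨P, hP⟩ := hf.size_le
  have h₁ : Efficient fun x => f (.cons x.head x.tail.head) :=
    hf.comp (g := fun x => .cons x.head x.tail.head) (.cons (.head .id) (.head (.tail .id)))
  have h₂ : EfficientFun fun x => .cons x.tail x.head.tail.tail :=
    .cons (.tail .id) (.tail (.tail (.head .id)))
  have h₃ := h₁.bind_cons h₂
  simp only [BinTree.head, BinTree.tail] at h₃
  refine Efficient.foldrM (step := fun p a s => (f (.cons p a)).bind fun y =>
    PMF.pure (.cons y s)) h₃ ⟨1 + P.comp (Polynomial.X + 1), fun p a s y hy => ?_⟩ hp hl .nil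
  rw [PMF.mem_support_bind_iff] at hy
  obtain ⟨z, hz, hy⟩ := hy
  simp only [PMF.support_pure, Set.mem_singleton_iff] at hy
  have := hP _ z hz
  simp only [hy, BinTree.size, Polynomial.eval_add, Polynomial.eval_one, Polynomial.eval_X,
    Polynomial.eval_comp] at this ⊢
  rw [show 1 + p.size + a.size = p.size + a.size + 1 by omega] at this
  omega

/-- An adversary can be composed with an efficient randomized function. -/
theorem Efficient.exists_qptAlg {f : BinTree → PMF BinTree} (hf : Efficient f) (A : QPTAlg) :
    ∃ B : QPTAlg, ∀ x, B.output x = (f x).bind A.output := by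
  obtain ⟨P, hP⟩ := hf.size_le
  obtain ⟨p, T, hp⟩ := hf
  let S : Polynomial ℕ := T + A.time.comp P + Polynomial.X
  have hS : ∀ x : BinTree, S.eval x.size = T.eval x.size + A.time.eval (P.eval x.size) + x.size :=
    fun x => by simp [S]
  -- The first program leaves the quantum memory at `init`, so `A` starts as in a fresh run except
  -- for a surplus of budget. By `budgetMono_exec` the surplus only shifts the remaining budget,
  -- which the output ignores.
  have key : ∀ x : BinTree, ∃ μ : PMF (BinTree × ℕ), μ.map Prod.fst = f x ∧
      (QProg.seq p A.prog).exec x (S.eval x.size) QState.init = μ.bind fun z =>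
        (A.prog.exec z.1 (A.time.eval z.1.size) QState.init).map
          (Option.map (addBudget (z.2 - A.time.eval z.1.size))) := by
    intro x
    obtain ⟨μ, h₁, h₂, h₃⟩ := hp x (S.eval x.size - x.size) QState.init (by
      rw [hS]; omega)
    refine ⟨μ, h₁, ?_⟩
    simp only [exec, tick]
    rw [if_neg (by rw [hS]; omega), h₃]
    unfold next
    rw [PMF.bind_map]
    refine PMF.bind_congr_support fun z hz => ?_
    have hz' : A.time.eval z.1.size ≤ A.time.eval (P.eval x.size) := by
      refine A.time.eval_nat_mono (hP x z.1 ?_)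
      rw [← h₁, PMF.mem_support_map_iff]
      exact ⟨z, hz, rfl⟩
    have h := h₂ z hz
    rw [hS] at h
    rw [← budgetMono_exec _ A.prog _ _ _ (A.halts z.1)]
    simp only [Function.comp]
    congr 1
    omega
  refine ⟨⟨QProg.seq p A.prog, S, fun x hx => ?_⟩, fun x => ?_⟩
  · obtain ⟨μ, _, h⟩ := key x
    rw [h, PMF.mem_support_bind_iff] at hx
    obtain ⟨z, _, hz⟩ := hx
    rw [PMF.mem_support_map_iff] at hz
    obtain ⟨r, hr, hz⟩ := hz
    cases r with
    | none => exact A.halts _ hr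
    | some r => simp at hz
  · obtain ⟨μ, h₁, h⟩ := key x
    simp only [QPTAlg.output]
    rw [h, ← h₁, PMF.bind_map, PMF.map_bind]
    refine congrArg μ.bind (funext fun z => ?_)
    rw [PMF.map_comp]
    refine PMF.map_congr_support fun r _ => ?_
    rcases r with _ | ⟨y, t, ψ⟩ <;> rfl

/-! ### Lists as values -/

namespace BinTree

theorem head_cons (a l : BinTree) : (cons a l).head = a := rfl

theorem tail_cons (a l : BinTree) : (cons a l).tail = l := rfl

/-- The length of a value, read as a list. -/
def length : BinTree → ℕ
  | nil => 0
  | cons _ l => l.length + 1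

theorem length_ofList (L : List BinTree) : (ofList L).length = L.length := by
  induction L with
  | nil => rfl
  | cons a L ih => simp [ofList, length, ih]

theorem length_unary (n : ℕ) : (unary n).length = n := by simp [unary, length_ofList]

theorem length_le_size (l : BinTree) : l.length ≤ l.size := by
  induction l with
  | nil => simp [length]
  | cons a l _ ih =>
    simp only [length, size]
    omega

theorem length_tail (l : BinTree) : l.tail.length = l.length - 1 := by
  cases l <;> simp [length, tail]

theorem length_tail_iterate (n : ℕ) (l : BinTree) : (tail^[n] l).length = l.length - n := by
  induction n with
  | zero => rfl
  | succ n ih => rw [Function.iterate_succ_apply', length_tail, ih]; omega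

theorem length_eq_zero {l : BinTree} : l.length = 0 ↔ l = nil := by
  cases l <;> simp [length]

theorem tail_iterate_eq_nil {n : ℕ} {l : BinTree} : tail^[n] l = nil ↔ l.length ≤ n := by
  rw [← length_eq_zero, length_tail_iterate]
  omega

theorem tail_iterate_ofList (n : ℕ) (L : List BinTree) :
    tail^[n] (ofList L) = ofList (L.drop n) := by
  induction n generalizing L with
  | zero => rfl
  | succ n ih =>
    rw [Function.iterate_succ_apply]
    cases L with
    | nil => simpa [ofList, tail] using ih []
    | cons a L => simpa [ofList, tail] using ih L

theorem head_tail_iterate_ofFn {m : ℕ} (x : Fin m → BinTree) (j : Fin m) :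
    (tail^[(j : ℕ)] (ofList (List.ofFn x))).head = x j := by
  rw [tail_iterate_ofList, List.drop_eq_getElem_cons (by simp)]
  simp [ofList, head]

/-- Prepend `nil` once for every entry of `l`. -/
def prependNils (l s : BinTree) : BinTree := foldr (fun _ _ s => cons nil s) nil l s

theorem prependNils_unary (l : BinTree) (n : ℕ) :
    prependNils l (unary n) = unary (l.length + n) := by
  unfold prependNils
  induction l with
  | nil => simp [foldr, length]
  | cons a l _ ih =>
    rw [foldr, ih, length, show l.length + 1 + n = (l.length + n) + 1 by omega]
    simp [unary, List.replicate_succ, ofList]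

theorem size_prependNils (l s : BinTree) : (prependNils l s).size = s.size + 2 * l.length := by
  unfold prependNils
  induction l with
  | nil => simp [foldr, length]
  | cons a l _ ih =>
    rw [foldr, length, size, ih]
    simp only [size]
    omega

/-- Remove one entry from `s` for every entry of `l`. -/
def dropBy (l s : BinTree) : BinTree := foldr (fun _ _ s => s.tail) nil l s

theorem dropBy_eq (l s : BinTree) : dropBy l s = tail^[l.length] s := by
  unfold dropBy
  induction l with
  | nil => rfl
  | cons a l _ ih => rw [foldr, ih, length, Function.iterate_succ_apply']

theorem size_dropBy_le (l s : BinTree) : (dropBy l s).size ≤ s.size := by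
  unfold dropBy
  induction l with
  | nil => exact le_rfl
  | cons a l _ ih => exact (size_tail_le _).trans ih

/-- For every entry of `l`, remove an entry from the second component of `s`, if there is one, and
prepend `nil` to the first component. -/
def moveBy (l s : BinTree) : BinTree :=
  foldr (fun _ _ s => if s.tail = nil then s else cons (cons nil s.head) s.tail.tail) nil l s

/-- Doubling a unary counter repeatedly would break any additive growth bound. Here each prepended
`nil` is paid for by a removed entry, so the size never increases. -/
theorem size_move_le (s : BinTree) :
    (if s.tail = nil then s else cons (cons nil s.head) s.tail.tail).size ≤ s.size := by
  split_ifs with h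
  · exact le_rfl
  · rcases s with _ | ⟨a, _ | ⟨b, c⟩⟩
    · exact absurd rfl h
    · exact absurd rfl h
    · have := b.one_le_size
      simp only [size, head, tail]
      omega

theorem size_moveBy_le (l s : BinTree) : (moveBy l s).size ≤ s.size := by
  unfold moveBy
  induction l with
  | nil => exact le_rfl
  | cons a l _ ih => exact (size_move_le _).trans ih

/-- Once the second component is exhausted, the first is no longer tracked: the range then already
covers the whole list and the counter is not read again. -/
theorem moveBy_eq (l r s : BinTree) : ∃ r', moveBy l (cons r s) = cons r' (tail^[l.length] s) ∧
    (tail^[l.length] s ≠ nil → r'.length = r.length + l.length) := by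
  unfold moveBy
  induction l with
  | nil => exact ⟨r, rfl, fun _ => rfl⟩
  | cons a l _ ih =>
    obtain ⟨r', h, hr⟩ := ih
    rw [foldr, h, length, Function.iterate_succ_apply']
    by_cases hn : tail^[l.length] s = nil
    · refine ⟨r', ?_, fun h => ?_⟩
      · simp [hn, tail]
      · simp [hn, tail] at h
    · refine ⟨cons nil r', ?_, fun _ => ?_⟩
      · simp [hn, tail, head]
      · rw [length, hr hn]
        omega

end BinTree

theorem EfficientFun.prependNils {f g : BinTree → BinTree} (hf : EfficientFun f)
    (hg : EfficientFun g) : EfficientFun fun x => BinTree.prependNils (f x) (g x) := by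
  refine EfficientFun.foldr (step := fun _ _ s => .cons .nil s)
    (.cons .nil (.tail (.tail .id))) 2 (fun p a s => ?_) .nil hf hg
  simp only [BinTree.size, Polynomial.eval_ofNat]
  omega

theorem EfficientFun.dropBy {f g : BinTree → BinTree} (hf : EfficientFun f)
    (hg : EfficientFun g) : EfficientFun fun x => BinTree.dropBy (f x) (g x) :=
  EfficientFun.foldr (step := fun _ _ s => s.tail) (.tail (.tail (.tail .id))) 0
    (fun _ _ s => by simpa using s.size_tail_le) .nil hf hg

theorem EfficientFun.moveBy {f g : BinTree → BinTree} (hf : EfficientFun f)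
    (hg : EfficientFun g) : EfficientFun fun x => BinTree.moveBy (f x) (g x) :=
  EfficientFun.foldr
    (step := fun _ _ s => if s.tail = BinTree.nil then s else .cons (.cons .nil s.head) s.tail.tail)
    (.ite (.tail (.tail (.tail .id))) (.tail (.tail .id))
      (.cons (.cons .nil (.head (.tail (.tail .id)))) (.tail (.tail (.tail (.tail .id))))))
    0 (fun _ _ s => by simpa using s.size_move_le) .nil hf hg

theorem EfficientFun.unary_const (n : ℕ) : EfficientFun fun _ => BinTree.unary n := by
  induction n with
  | zero => exact EfficientFun.nil
  | succ n ih => exact EfficientFun.cons .nil ih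

/-- Polynomials can be evaluated in unary. -/
theorem EfficientFun.unary_eval (Q : Polynomial ℕ) {g : BinTree → BinTree} (hg : EfficientFun g) :
    EfficientFun fun x => BinTree.unary (Q.eval (g x).length) := by
  induction Q using Polynomial.induction_on' with
  | add P Q hP hQ =>
    simpa [prependNils_unary, length_unary] using hP.prependNils hQ
  | monomial n a =>
    induction n with
    | zero => simpa using EfficientFun.unary_const a
    | succ n ih =>
      -- Unary multiplication: one copy of `u` is prepended per entry of `l`.
      have key : ∀ u l : BinTree, BinTree.foldr (fun p _ s => BinTree.prependNils p s) u l .nil =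
          BinTree.unary (u.length * l.length) := by
        intro u l
        induction l with
        | nil => rfl
        | cons b l _ ih =>
          rw [BinTree.foldr, ih, prependNils_unary, BinTree.length]
          congr 1
          ring
      have h := EfficientFun.foldr (step := fun p _ s => BinTree.prependNils p s)
        (EfficientFun.prependNils (.head .id) (.tail (.tail .id))) (2 * Polynomial.X)
        (fun p b s => by
          rw [size_prependNils]
          have := p.length_le_size
          simp only [Polynomial.eval_mul, Polynomial.eval_ofNat, Polynomial.eval_X]
          omega) ih hg .nil
      simp only [key, length_unary] at h
      simpa [Polynomial.eval_monomial, pow_succ, mul_assoc] using h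

/-! ### A random position in a list -/

/-- The uniform distribution on the numbers less than `2 ^ k`. -/
noncomputable def randomIndex : ℕ → PMF ℕ
  | 0 => PMF.pure 0
  | k + 1 => (randomIndex k).bind fun j =>
      (PMF.uniformOfFintype Bool).bind fun b => PMF.pure (if b then 2 ^ k + j else j)

namespace BinTree

/-- Double the range of the random position: the state consists of the suffix of a list from the
current position on, of the length `2 ^ k` of the range in unary, and of the part of the list
outside of the range. -/
noncomputable def doubleRange (s : BinTree) : PMF BinTree :=
  if s.tail.tail = nil then PMF.pure s
  else coinFlip.bind fun b =>
    PMF.pure (cons (if b = nil then s.head else dropBy s.tail.head s.head)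
      (moveBy s.tail.head s.tail))

/-- A suffix of `l` that starts at a random position, as the first component of the result. -/
noncomputable def randomSuffix (l : BinTree) : PMF BinTree :=
  foldrM (fun _ _ s => doubleRange s) nil l (cons l (cons (cons nil nil) l.tail))

/-- Here k counts the doublings so far. Each round doubles the range until 2 ^ k reaches the length
of `l`, after which the state is frozen; hence either the range is large enough or every round was a
doubling. The bound by `Nat.clog` says that no doubling is superfluous. -/
theorem foldrM_doubleRange (l l' : BinTree) : ∃ (k : ℕ) (r : BinTree),
    (l.length ≤ 2 ^ k ∨ l'.length ≤ k) ∧ k ≤ Nat.clog 2 l.length ∧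
    (2 ^ k < l.length → r.length = 2 ^ k) ∧
    foldrM (fun _ _ s => doubleRange s) nil l' (cons l (cons (cons nil nil) l.tail)) =
      (randomIndex k).bind fun j => PMF.pure (cons (tail^[j] l) (cons r (tail^[2 ^ k] l))) := by
  induction l' with
  | nil =>
    refine ⟨0, cons nil nil, Or.inr le_rfl, Nat.zero_le _, fun _ => rfl, ?_⟩
    simp [foldrM, randomIndex]
  | cons a l' _ ih =>
    obtain ⟨k, r, h₁, h₂, h₃, h₄⟩ := ih
    rw [foldrM, h₄, PMF.bind_bind]
    simp only [PMF.pure_bind, doubleRange, tail, head, tail_iterate_eq_nil]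
    by_cases hk : l.length ≤ 2 ^ k
    · exact ⟨k, r, Or.inl hk, h₂, h₃, by simp [hk]⟩
    · have hr := h₃ (not_le.1 hk)
      -- The counter `r` drives its own update, so its length goes from 2 ^ k to 2 ^ (k + 1).
      obtain ⟨r', h₅, h₆⟩ := moveBy_eq r r (tail^[2 ^ k] l)
      rw [hr, ← Function.iterate_add_apply, ← two_mul, ← pow_succ', Ne,
        tail_iterate_eq_nil] at h₆
      rw [hr, ← Function.iterate_add_apply, ← two_mul, ← pow_succ'] at h₅
      refine ⟨k + 1, r', ?_, ?_, fun h => ?_, ?_⟩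
      · rcases h₁ with h₁ | h₁
        · exact absurd h₁ hk
        · exact Or.inr (by rw [length]; omega)
      · exact (Nat.lt_clog_iff_pow_lt Nat.one_lt_two).2 (not_le.1 hk)
      · rw [h₆ (not_le.2 h), pow_succ']
      · simp only [if_neg hk, randomIndex, coinFlip, PMF.bind_bind, PMF.pure_bind, h₅,
          dropBy_eq, hr, ← Function.iterate_add_apply]
        refine congrArg _ (funext fun j => congrArg _ (funext fun b => ?_))
        cases b <;> simp [ofBool]

/-- Using `l` itself as the list of rounds suffices, as m ≤ 2 ^ m. Positions beyond the end of `l`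
can occur and yield `nil`. -/
theorem randomSuffix_eq (l : BinTree) : ∃ r : BinTree, randomSuffix l =
    (randomIndex (Nat.clog 2 l.length)).bind fun j => PMF.pure (cons (tail^[j] l) r) := by
  obtain ⟨k, r, h₁, h₂, _, h₄⟩ := foldrM_doubleRange l l
  have h : l.length ≤ 2 ^ k := h₁.elim (fun h => h) fun h => h.trans Nat.lt_two_pow_self.le
  rw [h₂.antisymm ((Nat.clog_le_iff_le_pow Nat.one_lt_two).2 h)] at h₄
  exact ⟨_, h₄⟩

end BinTree

theorem Efficient.doubleRange : Efficient doubleRange := by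
  refine Efficient.ite (.tail (.tail .id)) EfficientFun.id ?_
  have h : EfficientFun fun x => BinTree.cons
      (if x.tail = BinTree.nil then x.head.head else BinTree.dropBy x.head.tail.head x.head.head)
      (BinTree.moveBy x.head.tail.head x.head.tail) :=
    .cons (.ite (.tail .id) (.head (.head .id))
      (.dropBy (.head (.tail (.head .id))) (.head (.head .id))))
      (.moveBy (.head (.tail (.head .id))) (.tail (.head .id)))
  exact Efficient.coin.bind_cons h

theorem size_doubleRange_le {s y : BinTree} (hy : y ∈ (doubleRange s).support) :
    y.size ≤ s.size := by
  unfold doubleRange at hy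
  split_ifs at hy with h
  · simp only [PMF.support_pure, Set.mem_singleton_iff] at hy
    rw [hy]
  · rw [PMF.mem_support_bind_iff] at hy
    obtain ⟨b, _, hy⟩ := hy
    simp only [PMF.support_pure, Set.mem_singleton_iff] at hy
    rcases s with _ | ⟨a, s⟩
    · exact absurd rfl h
    · have h₁ := size_dropBy_le s.head a
      have h₂ := size_moveBy_le s.head s
      rw [hy]
      simp only [size, tail_cons, head_cons]
      split_ifs <;> omega

theorem Efficient.randomSuffix {g : BinTree → BinTree} (hg : EfficientFun g) :
    Efficient fun x => BinTree.randomSuffix (g x) :=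
  Efficient.foldrM (step := fun _ _ s => BinTree.doubleRange s)
    (Efficient.doubleRange.comp (.tail (.tail .id)))
    ⟨0, fun p a s y hy => by simpa using size_doubleRange_le hy⟩ .nil hg
    (.cons hg (.cons (.cons .nil .nil) (.tail hg)))

/-! ### Splicing -/

namespace BinTree

/-- `l` is a list of pairs and `c` a suffix of it. Return the first components of the pairs up to
and including the first pair of `c`, and then copies of the second component of that pair. -/
def splice (c l : BinTree) : BinTree :=
  (foldr (fun c a s => cons s.head.tail
    (cons (if s.head.tail = nil then a.head else c.head.tail) s.tail)) c l (cons c nil)).tail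

/-- Positions are compared without arithmetic: the right fold carries a copy of `c` that loses one
entry per step. If `c` is the suffix at position j, of length m - j, then m - i removals empty it
exactly when i ≤ j. -/
theorem foldr_splice (c : BinTree) {m : ℕ} (x : Fin m → BinTree) :
    foldr (fun c a s => cons s.head.tail
      (cons (if s.head.tail = nil then a.head else c.head.tail) s.tail)) c
      (ofList (List.ofFn x)) (cons c nil) =
    cons (tail^[m] c) (ofList (List.ofFn fun i : Fin m =>
      if tail^[m - i] c = nil then (x i).head else c.head.tail)) := by
  induction m with
  | zero => simp [foldr, ofList]
  | succ m ih =>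
    rw [List.ofFn_succ, ofList, foldr, ih, List.ofFn_succ, ofList]
    simp [head_cons, tail_cons, ← Function.iterate_succ_apply' tail]

theorem splice_tail_iterate {m : ℕ} (x y : Fin m → BinTree) (j : ℕ) :
    splice (tail^[j] (ofList (List.ofFn fun i => cons (x i) (y i))))
      (ofList (List.ofFn fun i => cons (x i) (y i))) =
    ofList (List.ofFn fun i : Fin m =>
      if h : (i : ℕ) ≤ j then x i else y ⟨j, (not_le.1 h).trans i.2⟩) := by
  rw [splice, foldr_splice, tail]
  congr 2
  funext i
  simp only [← Function.iterate_add_apply, tail_iterate_eq_nil, length_ofList, List.length_ofFn]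
  have hi := i.2
  by_cases h : (i : ℕ) ≤ j
  · rw [if_pos (by omega), dif_pos h, head]
  · rw [if_neg (by omega), dif_neg h]
    rw [head_tail_iterate_ofFn (fun i => cons (x i) (y i)) ⟨j, (not_le.1 h).trans i.2⟩, tail]

end BinTree

theorem EfficientFun.splice {f g : BinTree → BinTree} (hf : EfficientFun f)
    (hg : EfficientFun g) : EfficientFun fun x => BinTree.splice (f x) (g x) := by
  refine EfficientFun.tail (EfficientFun.foldr (step := fun c a s => .cons s.head.tail
    (.cons (if s.head.tail = BinTree.nil then a.head else c.head.tail) s.tail)) ?_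
    (Polynomial.X + 4) (fun c a s => ?_) hf hg (.cons hf .nil))
  · exact .cons (.tail (.head (.tail (.tail .id)))) (.cons
      (.ite (.tail (.head (.tail (.tail .id)))) (.head (.head (.tail .id)))
        (.tail (.head (.head .id)))) (.tail (.tail (.tail .id))))
  · have h₁ := a.size_head_le
    have h₂ := c.head.size_tail_le.trans c.size_head_le
    have h₃ := s.head.size_tail_le
    have h₄ : s.head.size + s.tail.size ≤ s.size + 1 := by
      cases s with
      | nil => simp [size, BinTree.head, BinTree.tail]
      | cons u v => simp only [head_cons, tail_cons, size]; omega
    simp only [size, Polynomial.eval_add, Polynomial.eval_X, Polynomial.eval_ofNat]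
    split_ifs <;> omega

/-! ### Approximate couplings -/

/-- A coupling of `p` and `q` that is concentrated on `R` up to probability `δ`. -/
def ApproxCouple {α β : Type} (δ : ℝ≥0∞) (R : α → β → Prop) (p : PMF α) (q : PMF β) : Prop :=
  ∃ r : α → β → ℝ≥0∞, (∀ a, ∑' b, r a b ≤ p a) ∧ (∀ b, ∑' a, r a b ≤ q b) ∧
    (∀ a b, r a b ≠ 0 → R a b) ∧ 1 ≤ (∑' a, ∑' b, r a b) + δ

namespace ApproxCouple

variable {α β α' β' : Type}

theorem mono {δ δ' : ℝ≥0∞} {R : α → β → Prop} {p : PMF α} {q : PMF β}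
    (h : ApproxCouple δ R p q) (hδ : δ ≤ δ') : ApproxCouple δ' R p q := by
  obtain ⟨r, h₁, h₂, h₃, h₄⟩ := h
  exact ⟨r, h₁, h₂, h₃, h₄.trans (by gcongr)⟩

theorem refl (p : PMF α) : ApproxCouple 0 Eq p p := by
  classical
  refine ⟨fun a b => if a = b then p a else 0, fun a => ?_, fun b => ?_, fun a b h => ?_, ?_⟩
  · simp
  · simp
  · by_contra hab
    exact h (if_neg hab)
  · simp [p.tsum_coe]

/-- Glue the couplings of `f a` and `g b` with the weights r a b. Pairs outside `R` have weight
zero, so nothing is needed there, and the missing masses add because r has total mass at most 1. -/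
theorem bind {δ δ' : ℝ≥0∞} {R : α → β → Prop} {R' : α' → β' → Prop} {p : PMF α} {q : PMF β}
    {f : α → PMF α'} {g : β → PMF β'} (h : ApproxCouple δ R p q)
    (h' : ∀ a b, R a b → ApproxCouple δ' R' (f a) (g b)) :
    ApproxCouple (δ + δ') R' (p.bind f) (q.bind g) := by
  obtain ⟨r, h₁, h₂, h₃, h₄⟩ := h
  have key : ∀ a b, ∃ r' : α' → β' → ℝ≥0∞, R a b → (∀ a', ∑' b', r' a' b' ≤ f a a') ∧
      (∀ b', ∑' a', r' a' b' ≤ g b b') ∧ (∀ a' b', r' a' b' ≠ 0 → R' a' b') ∧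
      1 ≤ (∑' a', ∑' b', r' a' b') + δ' := by
    intro a b
    by_cases hab : R a b
    · obtain ⟨r', h⟩ := h' a b hab
      exact ⟨r', fun _ => h⟩
    · exact ⟨0, fun h => absurd h hab⟩
  choose r' hr' using key
  refine ⟨fun a' b' => ∑' a, ∑' b, r a b * r' a b a' b', fun a' => ?_, fun b' => ?_,
    fun a' b' hab => ?_, ?_⟩
  · rw [PMF.bind_apply, ENNReal.tsum_comm]
    refine ENNReal.tsum_le_tsum fun a => ?_
    rw [ENNReal.tsum_comm]
    refine le_trans (ENNReal.tsum_le_tsum fun b => ?_)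
      ((ENNReal.tsum_mul_right (f := r a) (a := f a a')).le.trans (by gcongr; exact h₁ a))
    rw [ENNReal.tsum_mul_left]
    by_cases h0 : r a b = 0
    · simp [h0]
    · gcongr
      exact (hr' a b (h₃ a b h0)).1 a'
  · rw [PMF.bind_apply, ENNReal.tsum_comm]
    simp_rw [fun a => ENNReal.tsum_comm (f := fun (a' : α') b => r a b * r' a b a' b')]
    rw [ENNReal.tsum_comm]
    refine ENNReal.tsum_le_tsum fun b => ?_
    refine le_trans (ENNReal.tsum_le_tsum fun a => ?_)
      ((ENNReal.tsum_mul_right (f := fun a => r a b) (a := g b b')).le.trans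
        (by gcongr; exact h₂ b))
    rw [ENNReal.tsum_mul_left]
    by_cases h0 : r a b = 0
    · simp [h0]
    · gcongr
      exact (hr' a b (h₃ a b h0)).2.1 b'
  · by_contra hR
    refine hab (ENNReal.tsum_eq_zero.2 fun a => ENNReal.tsum_eq_zero.2 fun b => ?_)
    by_contra h0
    rw [mul_eq_zero, not_or] at h0
    exact hR ((hr' a b (h₃ a b h0.1)).2.2.1 a' b' h0.2)
  · have hsum : ∑' a', ∑' b', ∑' a, ∑' b, r a b * r' a b a' b' =
        ∑' a, ∑' b, r a b * ∑' a', ∑' b', r' a b a' b' := by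
      calc _ = ∑' a', ∑' a, ∑' b', ∑' b, r a b * r' a b a' b' :=
            tsum_congr fun a' => ENNReal.tsum_comm
        _ = ∑' a, ∑' a', ∑' b', ∑' b, r a b * r' a b a' b' := ENNReal.tsum_comm
        _ = ∑' a, ∑' a', ∑' b, ∑' b', r a b * r' a b a' b' :=
            tsum_congr fun a => tsum_congr fun a' => ENNReal.tsum_comm
        _ = ∑' a, ∑' b, ∑' a', ∑' b', r a b * r' a b a' b' :=
            tsum_congr fun a => ENNReal.tsum_comm
        _ = _ := by simp only [ENNReal.tsum_mul_left]
    have htotal : ∑' a, ∑' b, r a b ≤ 1 :=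
      (ENNReal.tsum_le_tsum h₁).trans p.tsum_coe.le
    have hstep : ∑' a, ∑' b, r a b ≤
        (∑' a, ∑' b, r a b * ∑' a', ∑' b', r' a b a' b') + δ' := by
      calc ∑' a, ∑' b, r a b
          ≤ ∑' a, ∑' b, (r a b * (∑' a', ∑' b', r' a b a' b') + r a b * δ') := by
            refine ENNReal.tsum_le_tsum fun a => ENNReal.tsum_le_tsum fun b => ?_
            by_cases h0 : r a b = 0
            · simp [h0]
            · rw [← mul_add]
              exact le_mul_of_one_le_right' (hr' a b (h₃ a b h0)).2.2.2
        _ = (∑' a, ∑' b, r a b * ∑' a', ∑' b', r' a b a' b') +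
              (∑' a, ∑' b, r a b) * δ' := by
            simp only [ENNReal.tsum_add, ENNReal.tsum_mul_right]
        _ ≤ _ := by
            gcongr
            exact mul_le_of_le_one_left' htotal
    rw [hsum]
    calc (1 : ℝ≥0∞) ≤ (∑' a, ∑' b, r a b) + δ := h₄
      _ ≤ ((∑' a, ∑' b, r a b * ∑' a', ∑' b', r' a b a' b') + δ') + δ := by gcongr
      _ = _ := by ring

theorem bind_right (p : PMF α) {δ : ℝ≥0∞} {R : α' → β' → Prop} {f : α → PMF α'}
    {g : α → PMF β'} (h : ∀ a, ApproxCouple δ R (f a) (g a)) :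
    ApproxCouple δ R (p.bind f) (p.bind g) :=
  ((refl p).bind (δ' := δ) fun a _ hab => hab ▸ h a).mono (zero_add δ).le

theorem bind_left {δ : ℝ≥0∞} {p q : PMF α} (h : ApproxCouple δ Eq p q) (f : α → PMF α') :
    ApproxCouple δ Eq (p.bind f) (q.bind f) :=
  (h.bind (δ' := 0) fun a _ hab => hab ▸ refl (f a)).mono (add_zero δ).le

/-- Turns the success probability of an algorithm into a coupling with its ideal, deterministic
answer. -/
theorem of_prob {δ : ℝ≥0∞} {R : α → β → Prop} {p : PMF α} {E : Set α} {b : β}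
    (h : 1 ≤ p.toOuterMeasure E + δ) (hE : ∀ a ∈ E, R a b) :
    ApproxCouple δ R p (PMF.pure b) := by
  classical
  refine ⟨fun a b' => if b' = b then E.indicator p a else 0, fun a => ?_, fun b' => ?_,
    fun a b' hab => ?_, ?_⟩
  · rw [tsum_ite_eq]
    exact Set.indicator_le_self E p a
  · rw [PMF.pure_apply]
    by_cases hb : b' = b
    · simp only [if_pos hb]
      exact (ENNReal.tsum_le_tsum fun a => Set.indicator_le_self E p a).trans p.tsum_coe.le
    · simp [if_neg hb]
  · simp only [ne_eq, ite_eq_right_iff, Set.indicator_apply_eq_zero, Classical.not_imp] at hab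
    exact hab.1 ▸ hE a hab.2.1
  · simpa only [tsum_ite_eq, ← PMF.toOuterMeasure_apply] using h

/-- If `R` relates each `a` to at most one `b`, it is enough that the events in `β` are about as
probable under `p`. -/
theorem of_functional [Finite β] {δ : ℝ≥0∞} {R : α → β → Prop} {p : PMF α} {q : PMF β}
    (hR : ∀ a b b', R a b → R a b' → b = b')
    (h : ∀ E : Set β, q.toOuterMeasure E ≤ p.toOuterMeasure {a | ∃ b ∈ E, R a b} + δ) :
    ApproxCouple δ R p q := by
  classical
  have := Fintype.ofFinite β
  set v : β → ℝ≥0∞ := fun b => p.toOuterMeasure {a | R a b} with hv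
  have hv1 : ∀ b, v b ≠ ⊤ := fun b => ne_top_of_le_ne_top ENNReal.one_ne_top <| by
    simp only [hv, PMF.toOuterMeasure_apply]
    exact (ENNReal.tsum_le_tsum fun a => Set.indicator_le_self _ p a).trans p.tsum_coe.le
  -- Each b receives the mass `min (v b) (q b)`, spread over its fibre {a | R a b} proportionally to
  -- `p`. The fibres are disjoint, so the mass taken from each a is at most p a.
  have hcol : ∀ b, ∑' a, (if R a b then p a * (min (v b) (q b) / v b) else 0) =
      min (v b) (q b) := by
    intro b
    have : ∀ a, (if R a b then p a * (min (v b) (q b) / v b) else 0) =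
        Set.indicator {a | R a b} p a * (min (v b) (q b) / v b) := by
      intro a
      simp only [Set.indicator_apply, Set.mem_ofPred_eq]
      split_ifs <;> simp
    rw [tsum_congr this, ENNReal.tsum_mul_right, ← PMF.toOuterMeasure_apply]
    change v b * _ = _
    by_cases h0 : v b = 0
    · simp [h0]
    · exact ENNReal.mul_div_cancel h0 (hv1 b)
  refine ⟨fun a b => if R a b then p a * (min (v b) (q b) / v b) else 0, fun a => ?_,
    fun b => ?_, fun a b hab => ?_, ?_⟩
  · by_cases ha : ∃ b, R a b
    · obtain ⟨b, hb⟩ := ha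
      rw [tsum_eq_single b fun b' hb' => if_neg fun h => hb' (hR a b' b h hb), if_pos hb]
      refine mul_le_of_le_one_right' (ENNReal.div_le_of_le_mul ?_)
      rw [one_mul]
      exact min_le_left _ _
    · simp [not_exists.1 ha]
  · rw [hcol]
    exact min_le_right _ _
  · by_contra hab'
    exact hab (if_neg hab')
  · rw [ENNReal.tsum_comm, tsum_congr hcol, tsum_fintype]
    -- The extremal event: the total mass of the minima is the sum of `v` over `E` plus that of `q`
    -- off `E`.
    set E : Set β := {b | v b ≤ q b} with hE
    have h₁ : p.toOuterMeasure {a | ∃ b ∈ E, R a b} ≤ ∑ b, if b ∈ E then v b else 0 := by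
      have hU : {a | ∃ b ∈ E, R a b} = ⋃ b ∈ Finset.univ.filter (· ∈ E), {a | R a b} := by
        ext a
        simp
      rw [hU, ← Finset.sum_filter]
      exact MeasureTheory.measure_biUnion_finset_le _ _
    have h₂ : (1 : ℝ≥0∞) = q.toOuterMeasure E + ∑ b, if b ∈ E then 0 else q b := by
      rw [PMF.toOuterMeasure_apply_fintype, ← Finset.sum_add_distrib, ← q.tsum_coe, tsum_fintype]
      refine Finset.sum_congr rfl fun b _ => ?_
      rw [Set.indicator_apply]
      split_ifs <;> simp
    calc (1 : ℝ≥0∞) = q.toOuterMeasure E + ∑ b, if b ∈ E then 0 else q b := h₂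
      _ ≤ ((∑ b, if b ∈ E then v b else 0) + δ) + ∑ b, if b ∈ E then 0 else q b := by
          gcongr
          exact (h E).trans (by gcongr)
      _ = (∑ b, ((if b ∈ E then v b else 0) + if b ∈ E then 0 else q b)) + δ := by
          rw [Finset.sum_add_distrib]
          ring
      _ = _ := by
          congr 1
          refine Finset.sum_congr rfl fun b _ => ?_
          by_cases hb : b ∈ E
          · rw [if_pos hb, if_pos hb, add_zero, min_eq_left hb]
          · rw [if_neg hb, if_neg hb, zero_add, min_eq_right (not_le.1 hb).le]

theorem symm {δ : ℝ≥0∞} {p q : PMF α} (h : ApproxCouple δ Eq p q) : ApproxCouple δ Eq q p := by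
  obtain ⟨r, h₁, h₂, h₃, h₄⟩ := h
  refine ⟨fun a b => r b a, h₂, h₁, fun a b hab => (h₃ b a hab).symm, ?_⟩
  rwa [ENNReal.tsum_comm]

/-- The coupling lives on the diagonal, where it is below both `p` and `q`. Bounding it by `q` on
`E` and by `p` off `E` gives 1 ≤ q(E) + p(Eᶜ) + δ. -/
theorem toOuterMeasure_le {δ : ℝ≥0∞} {p q : PMF α} (h : ApproxCouple δ Eq p q) (E : Set α) :
    p.toOuterMeasure E ≤ q.toOuterMeasure E + δ := by
  classical
  obtain ⟨r, h₁, h₂, h₃, h₄⟩ := h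
  have hdiag : ∀ a, ∑' b, r a b = r a a := fun a =>
    tsum_eq_single a fun b hb => by_contra fun h => hb (h₃ a b h).symm
  have hdiag' : ∀ b, ∑' a, r a b = r b b := fun b =>
    tsum_eq_single b fun a hb => by_contra fun h => hb (h₃ a b h)
  simp only [hdiag] at h₁ h₄
  simp only [hdiag'] at h₂
  have hp : p.toOuterMeasure E + p.toOuterMeasure Eᶜ = 1 := by
    rw [PMF.toOuterMeasure_apply, PMF.toOuterMeasure_apply, ← ENNReal.tsum_add, ← p.tsum_coe]
    exact tsum_congr fun a => Set.indicator_self_add_compl_apply E p a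
  have hr : ∑' a, r a a ≤ q.toOuterMeasure E + p.toOuterMeasure Eᶜ := by
    rw [PMF.toOuterMeasure_apply, PMF.toOuterMeasure_apply, ← ENNReal.tsum_add]
    refine ENNReal.tsum_le_tsum fun a => ?_
    by_cases ha : a ∈ E
    · simp [ha, h₂ a]
    · simp [ha, h₁ a]
  have hfin : p.toOuterMeasure Eᶜ ≠ ⊤ :=
    ne_top_of_le_ne_top ENNReal.one_ne_top (hp ▸ le_add_self)
  rw [← ENNReal.add_le_add_iff_right hfin, hp]
  calc (1 : ℝ≥0∞) ≤ (∑' a, r a a) + δ := h₄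
    _ ≤ (q.toOuterMeasure E + p.toOuterMeasure Eᶜ) + δ := by gcongr
    _ = _ := by ring

end ApproxCouple

/-! ### Couplings and real-valued probabilities -/

theorem toOuterMeasure_le_one {α : Type} (p : PMF α) (E : Set α) : p.toOuterMeasure E ≤ 1 := by
  rw [PMF.toOuterMeasure_apply]
  exact (ENNReal.tsum_le_tsum fun a => Set.indicator_le_self E p a).trans p.tsum_coe.le

theorem ofReal_prob {α : Type} (p : PMF α) (E : Set α) :
    ENNReal.ofReal (prob p E) = p.toOuterMeasure E :=
  ENNReal.ofReal_toReal (ne_top_of_le_ne_top ENNReal.one_ne_top (toOuterMeasure_le_one p E))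

theorem prob_nonneg {α : Type} (p : PMF α) (E : Set α) : 0 ≤ prob p E := ENNReal.toReal_nonneg

theorem ApproxCouple.abs_prob_sub_le {α : Type} {δ : ℝ} (hδ : 0 ≤ δ) {p q : PMF α}
    (h : ApproxCouple (ENNReal.ofReal δ) Eq p q) (E : Set α) : |prob p E - prob q E| ≤ δ := by
  have key : ∀ {p q : PMF α}, ApproxCouple (ENNReal.ofReal δ) Eq p q →
      prob p E ≤ prob q E + δ := by
    intro p q h
    have := h.toOuterMeasure_le E
    rw [← ofReal_prob, ← ofReal_prob, ← ENNReal.ofReal_add (prob_nonneg _ _) hδ] at this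
    exact (ENNReal.ofReal_le_ofReal_iff (add_nonneg (prob_nonneg _ _) hδ)).1 this
  rw [abs_sub_le_iff]
  constructor
  · linarith [key h]
  · linarith [key h.symm]

theorem ApproxCouple.of_le_prob {α β : Type} {ε : ℝ} {R : α → β → Prop} {p : PMF α} {E : Set α}
    {b : β} (h : 1 - ε ≤ prob p E) (hE : ∀ a ∈ E, R a b) :
    ApproxCouple (ENNReal.ofReal ε) R p (PMF.pure b) := by
  refine ApproxCouple.of_prob (E := E) ?_ hE
  rw [← ofReal_prob, ← ENNReal.ofReal_one]
  exact (ENNReal.ofReal_le_ofReal (by linarith)).trans ENNReal.ofReal_add_le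

theorem prob_bind_randomIndex {α : Type} (E : Set α) (k : ℕ) :
    ∀ f : ℕ → PMF α, prob ((randomIndex k).bind f) E =
      (∑ j ∈ Finset.range (2 ^ k), prob (f j) E) / 2 ^ k := by
  have hbool : ∀ f : Bool → PMF α, prob ((PMF.uniformOfFintype Bool).bind f) E =
      (prob (f false) E + prob (f true) E) / 2 := by
    intro f
    have hne : ∀ b, (2 : ℝ≥0∞)⁻¹ * (f b).toOuterMeasure E ≠ ⊤ := fun b =>
      ENNReal.mul_ne_top (by simp)
        (ne_top_of_le_ne_top ENNReal.one_ne_top (toOuterMeasure_le_one _ _))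
    simp only [prob, PMF.toOuterMeasure_bind_apply, PMF.uniformOfFintype_apply,
      Fintype.card_bool, tsum_bool, Nat.cast_ofNat]
    rw [ENNReal.toReal_add (hne _) (hne _)]
    simp only [ENNReal.toReal_mul, ENNReal.toReal_inv, ENNReal.toReal_ofNat]
    ring
  induction k with
  | zero => intro f; simp [randomIndex]
  | succ k ih =>
    intro f
    rw [randomIndex, PMF.bind_bind, ih]
    simp only [PMF.bind_bind, PMF.pure_bind, hbool, if_true, Bool.false_eq_true, if_false]
    rw [pow_succ, mul_two, Finset.sum_range_add, ← Finset.sum_div, Finset.sum_add_distrib]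
    rw [div_div]
    congr 1
    ring

/-! ### Uniform distributions -/

namespace PMF

variable {α β γ : Type} [Fintype α] [Nonempty α] [Fintype β] [Nonempty β]

theorem uniformOfFintype_bind_equiv (e : α ≃ β) (f : β → PMF γ) :
    ((uniformOfFintype α).bind fun a => f (e a)) = (uniformOfFintype β).bind f := by
  ext c
  simp only [bind_apply, uniformOfFintype_apply, Fintype.card_congr e]
  exact e.tsum_eq fun b => (Fintype.card β : ℝ≥0∞)⁻¹ * f b c

theorem uniformOfFintype_bind_prod (f : α → β → PMF γ) :
    ((uniformOfFintype α).bind fun a => (uniformOfFintype β).bind fun b => f a b) =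
      (uniformOfFintype (α × β)).bind fun x => f x.1 x.2 := by
  ext c
  simp only [bind_apply, uniformOfFintype_apply, Fintype.card_prod, Nat.cast_mul]
  rw [ENNReal.tsum_prod', ENNReal.mul_inv (Or.inr (by simp)) (Or.inl (by simp))]
  simp only [mul_assoc, ENNReal.tsum_mul_left]

theorem uniformOfFintype_bind_cons {m : ℕ} (f : (Fin (m + 1) → α) → PMF γ) :
    (uniformOfFintype (Fin (m + 1) → α)).bind f =
      (uniformOfFintype (Fin m → α)).bind fun t => (uniformOfFintype α).bind fun a =>
        f (Fin.cons a t) := by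
  rw [bind_comm, uniformOfFintype_bind_prod,
    ← uniformOfFintype_bind_equiv (Fin.consEquiv fun _ => α)]
  rfl

/-- Exchanging a coordinate with an independent sample does not change the joint distribution. -/
theorem uniformOfFintype_bind_update {ι : Type} [Fintype ι] [DecidableEq ι] (j : ι)
    (f : (ι → α) → α → PMF γ) :
    ((uniformOfFintype (ι → α)).bind fun s => (uniformOfFintype α).bind fun a =>
      f (Function.update s j a) (s j)) =
      (uniformOfFintype (ι → α)).bind fun s => (uniformOfFintype α).bind fun a => f s a := by
  have hinv : Function.Involutive fun x : (ι → α) × α => (Function.update x.1 j x.2, x.1 j) := by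
    rintro ⟨s, a⟩
    simp
  rw [uniformOfFintype_bind_prod, uniformOfFintype_bind_prod,
    ← uniformOfFintype_bind_equiv hinv.toPerm]
  simp

theorem uniformOfFintype_bind_eval {ι : Type} [Fintype ι] [DecidableEq ι] (j : ι)
    (f : α → PMF γ) : ((uniformOfFintype (ι → α)).bind fun s => f (s j)) =
      (uniformOfFintype α).bind f := by
  simpa [bind_const] using uniformOfFintype_bind_update j fun (_ : ι → α) a => f a

theorem uniformOfFintype_bind_update_self {ι : Type} [Fintype ι] [DecidableEq ι] (j : ι)
    (f : (ι → α) → PMF γ) : ((uniformOfFintype (ι → α)).bind fun s =>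
      (uniformOfFintype α).bind fun a => f (Function.update s j a)) =
      (uniformOfFintype (ι → α)).bind f := by
  simpa [bind_const] using uniformOfFintype_bind_update j fun s _ => f s

end PMF

/-! ### Negligible functions and indistinguishability -/

theorem Negligible.of_le {f g : ℕ → ℝ} (hg : Negligible g) (h0 : ∀ n, 0 ≤ f n)
    (h : ∀ n, f n ≤ g n) : Negligible f :=
  hg.trans_abs_le fun n => by
    simp only [abs_of_nonneg (h0 n)]
    exact (h n).trans (le_abs_self _)

theorem Negligible.polynomial_mul {f : ℕ → ℝ} (hf : Negligible f) (P : Polynomial ℕ) :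
    Negligible fun n => ((P.eval n : ℕ) : ℝ) * f n := by
  have h := Asymptotics.SuperpolynomialDecay.polynomial_mul hf (P.map (Nat.castRingHom ℝ))
  refine h.congr fun n => ?_
  rw [Polynomial.eval_natCast_map]
  rfl

theorem CompIndist.symm {D D' : ℕ → PMF BinTree} (h : CompIndist D D') : CompIndist D' D :=
  fun A => (h A).congr fun _ => abs_sub_comm _ _

theorem CompIndist.trans {D D' D'' : ℕ → PMF BinTree} (h : CompIndist D D')
    (h' : CompIndist D' D'') : CompIndist D D'' := fun A =>
  Negligible.of_le ((h A).add (h' A)) (fun _ => abs_nonneg _) fun _ => abs_sub_le _ _ _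

/-- The reduction retains its own copy of 1ⁿ, which `A` needs besides the transformed sample. -/
theorem Efficient.exists_reduction {f : BinTree → PMF BinTree} (hf : Efficient f) (A : QPTAlg) :
    ∃ B : QPTAlg, ∀ n x, B.run n x = (f (.cons (.unary n) x)).bind (A.run n) := by
  have h : EfficientFun fun x => .cons x.head.head x.tail := .cons (.head (.head .id)) (.tail .id)
  obtain ⟨B, hB⟩ := (hf.bind_cons h).exists_qptAlg A
  refine ⟨B, fun n x => ?_⟩
  rw [QPTAlg.run, hB]
  simp only [PMF.bind_bind, PMF.pure_bind, BinTree.head, BinTree.tail]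
  rfl

/-- Indistinguishability is preserved by efficient randomized functions, also if these are only
approximated up to a negligible error. -/
theorem CompIndist.map {D D' E E' : ℕ → PMF BinTree} (h : CompIndist D D')
    {f : BinTree → PMF BinTree} (hf : Efficient f) {δ : ℕ → ℝ} (hδ : Negligible δ)
    (hδ0 : ∀ n, 0 ≤ δ n)
    (hE : ∀ n, ApproxCouple (ENNReal.ofReal (δ n)) Eq
      ((D n).bind fun x => f (.cons (.unary n) x)) (E n))
    (hE' : ∀ n, ApproxCouple (ENNReal.ofReal (δ n)) Eq
      ((D' n).bind fun x => f (.cons (.unary n) x)) (E' n)) : CompIndist E E' := by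
  intro A
  obtain ⟨B, hB⟩ := hf.exists_reduction A
  refine Negligible.of_le ((h B).add (hδ.add hδ)) (fun _ => abs_nonneg _) fun n => ?_
  have h₁ := ((hE n).bind_left (A.run n)).abs_prob_sub_le (hδ0 n) {BinTree.ofBool true}
  have h₂ := ((hE' n).bind_left (A.run n)).abs_prob_sub_le (hδ0 n) {BinTree.ofBool true}
  simp only [PMF.bind_bind, ← hB] at h₁ h₂
  simp only [Pi.add_apply]
  rw [abs_le] at h₁ h₂ ⊢
  have h₃ := abs_le.1 (le_refl |prob ((D n).bind (B.run n)) {BinTree.ofBool true} -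
    prob ((D' n).bind (B.run n)) {BinTree.ofBool true}|)
  constructor <;> linarith [h₁.1, h₁.2, h₂.1, h₂.2, h₃.1, h₃.2]

/-! ### Encodings, and independent sampling along a list -/

theorem BinTree.ofBits_injective : Function.Injective BinTree.ofBits := by
  have hlist : Function.Injective BinTree.ofList := by
    intro L
    induction L with
    | nil => intro L' h; cases L' with
      | nil => rfl
      | cons b L' => simp [ofList] at h
    | cons a L ih => intro L' h; cases L' with
      | nil => simp [ofList] at h
      | cons b L' =>
        simp only [ofList, BinTree.cons.injEq] at h
        rw [h.1, ih h.2]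
  have hbool : Function.Injective BinTree.ofBool := by
    intro a b h
    cases a <;> cases b <;> simp_all [ofBool]
  exact hlist.comp (List.map_injective_iff.2 hbool)

/-- Mapping a function over a list yields independent samples. -/
theorem approxCouple_mapM {α : Type} [Fintype α] [Nonempty α] {f : BinTree → PMF BinTree}
    {p : BinTree} {δ : ℝ≥0∞} : ∀ {m : ℕ} {x : Fin m → BinTree} {φ : Fin m → α → BinTree},
    (∀ i, ApproxCouple δ Eq (f (cons p (x i)))
      ((PMF.uniformOfFintype α).bind fun a => PMF.pure (φ i a))) →
    ApproxCouple (m * δ) Eq (mapM f p (ofList (List.ofFn x)))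
      ((PMF.uniformOfFintype (Fin m → α)).bind fun a =>
        PMF.pure (ofList (List.ofFn fun i => φ i (a i))))
  | 0, x, φ, _ => by
    simpa [mapM, foldrM, ofList, PMF.bind_const] using ApproxCouple.refl (PMF.pure BinTree.nil)
  | m + 1, x, φ, h => by
    have ih := approxCouple_mapM (x := fun i => x i.succ) (φ := fun i => φ i.succ)
      fun i => h i.succ
    -- The right fold treats the tail before the head, matching the order in which the uniform
    -- function is split; the errors δ of the entries add up.
    rw [PMF.uniformOfFintype_bind_cons]
    simp only [List.ofFn_succ, ofList, mapM, foldrM, Fin.cons_zero, Fin.cons_succ] at ih ⊢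
    have key := ih.bind (R' := Eq)
      (f := fun s => (f (cons p (x 0))).bind fun y => PMF.pure (cons y s))
      (g := fun s => ((PMF.uniformOfFintype α).bind fun a => PMF.pure (φ 0 a)).bind fun y =>
        PMF.pure (cons y s)) (δ' := δ) fun s s' hs => by
          rw [hs]
          exact (h 0).bind_left _
    simp only [PMF.bind_bind, PMF.pure_bind] at key
    convert key using 1
    push_cast
    ring

theorem approxCouple_mapM_pure {f : BinTree → PMF BinTree} {p : BinTree} {δ : ℝ≥0∞} {m : ℕ}
    {x φ : Fin m → BinTree}
    (h : ∀ i, ApproxCouple δ Eq (f (cons p (x i))) (PMF.pure (φ i))) :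
    ApproxCouple (m * δ) Eq (mapM f p (ofList (List.ofFn x)))
      (PMF.pure (ofList (List.ofFn φ))) := by
  simpa [PMF.bind_const] using approxCouple_mapM (α := Unit) (φ := fun i _ => φ i) (x := x)
    fun i => by simpa [PMF.bind_const] using h i

/-! ### Effective group actions as efficient randomized functions -/

namespace GroupActionFamily

variable {F : GroupActionFamily}

/-- The value `d` represents the group element `g`. -/
def Represents {n : ℕ} (d : BinTree) (g : F.G n) : Prop :=
  ∃ z, d = ofBits z ∧ F.decG n z = some g

/-- A list of set elements as a value. -/
noncomputable def encList (F : GroupActionFamily) {n Q : ℕ} (s : Fin Q → F.S n) : BinTree :=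
  ofList (List.ofFn fun i => F.enc (s i))

/-- A group element may have many representations, so the sample is compared with the uniform
distribution along `Represents`. A value represents at most one element, hence closeness on events
gives a coupling by `of_functional`. -/
theorem IsEffective.exists_sampler (hE : F.IsEffective) : ∃ f, Efficient f ∧
    ∃ η : ℕ → ℝ, Negligible η ∧ (∀ n, 0 ≤ η n) ∧ ∀ n,
      ApproxCouple (ENNReal.ofReal (η n)) Represents (f (cons (unary n) nil))
        (PMF.uniformOfFintype (F.G n)) := by
  obtain ⟨M, hM, η, hη, h⟩ := hE.sampleG
  have h0 : ∀ n, 0 ≤ η n := fun n => (abs_nonneg _).trans (h n ∅)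
  refine ⟨M.output, M.efficient hM, η, hη, h0, fun n => ?_⟩
  refine ApproxCouple.of_functional ?_ fun E => ?_
  · rintro _ g g' ⟨z, rfl, hz⟩ ⟨z', hzz, hz'⟩
    rw [ofBits_injective hzz, hz'] at hz
    exact (Option.some.inj hz).symm
  · have hset : {d | ∃ g ∈ E, Represents d g} =
        {d | ∃ z, d = ofBits z ∧ ∃ g ∈ E, F.decG n z = some g} := by
      ext d
      constructor
      · rintro ⟨g, hg, z, hd, hz⟩
        exact ⟨z, hd, g, hg, hz⟩
      · rintro ⟨z, hd, g, hg, hz⟩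
        exact ⟨g, hg, z, hd, hz⟩
    have := (abs_le.1 (h n E)).1
    rw [hset, ← ofReal_prob, ← ofReal_prob, ← ENNReal.ofReal_add (prob_nonneg _ _) (h0 n)]
    refine ENNReal.ofReal_le_ofReal ?_
    rw [QPTAlg.run] at this
    linarith

/-- Acting yields some representation, which could leak information about the one chosen for g.
Passing to the canonical representation makes the output depend on g • s alone, up to the error. -/
theorem IsEffective.exists_act (hE : F.IsEffective) : ∃ f, Efficient f ∧
    ∃ η : ℕ → ℝ, Negligible η ∧ (∀ n, 0 ≤ η n) ∧
      ∀ n d (g : F.G n) (s : F.S n), Represents d g →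
        ApproxCouple (ENNReal.ofReal (η n)) Eq (f (cons (unary n) (cons d (F.enc s))))
          (PMF.pure (F.enc (g • s))) := by
  obtain ⟨M, hM, ε, hε, h⟩ := hE.act
  obtain ⟨M', hM', ε', hε', h'⟩ := hE.canonS
  -- The given errors may be negative; absolute values keep the total nonnegative.
  have hη : Negligible fun n => |ε n| + |ε' n| :=
    (hε.trans_abs_le fun n => (abs_abs (ε n)).le).add
      (hε'.trans_abs_le fun n => (abs_abs (ε' n)).le)
  have hf : EfficientFun fun x => cons x.head.head x.tail := .cons (.head (.head .id)) (.tail .id)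
  refine ⟨_, (M.efficient hM).bind_cons ((M'.efficient hM').comp hf), _, hη,
    fun n => add_nonneg (abs_nonneg _) (abs_nonneg _), ?_⟩
  rintro n _ g s ⟨z, rfl, hz⟩
  simp only [head_cons, tail_cons]
  have h₁ := ApproxCouple.of_le_prob (b := ()) (h n z (F.canon n s) g s hz (F.decS_canon n s))
    (R := fun d _ => ∃ w, d = ofBits w ∧ F.decS n w = some (g • s)) fun d hd => hd
  have h₂ := h₁.bind (R' := Eq) (f := fun y => M'.output (cons (unary n) y))
    (g := fun _ => PMF.pure (F.enc (g • s))) (δ' := ENNReal.ofReal (ε' n)) (by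
      rintro _ _ ⟨w, rfl, hw⟩
      refine ApproxCouple.of_le_prob (h' n w _ hw) fun a ha => ?_
      simpa [enc] using ha)
  rw [PMF.pure_bind] at h₂
  refine h₂.mono ?_
  rw [ENNReal.ofReal_add (abs_nonneg _) (abs_nonneg _)]
  gcongr <;> exact le_abs_self _

/-- Random elements of the orbit of a given set element can be sampled. -/
theorem IsEffective.exists_orbitSampler (hE : F.IsEffective) : ∃ f, Efficient f ∧
    ∃ η : ℕ → ℝ, Negligible η ∧ (∀ n, 0 ≤ η n) ∧ ∀ n (s : F.S n),
      ApproxCouple (ENNReal.ofReal (η n)) Eq (f (cons (unary n) (F.enc s)))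
        ((PMF.uniformOfFintype (F.G n)).bind fun g => PMF.pure (F.enc (g • s))) := by
  obtain ⟨f, hf, η, hη, hη0, h⟩ := hE.exists_sampler
  obtain ⟨f', hf', η', hη', hη0', h'⟩ := hE.exists_act
  have h₁ : EfficientFun fun x => cons x.head nil := .cons (.head .id) .nil
  have h₂ : EfficientFun fun x => cons x.head.head (cons x.tail x.head.tail) :=
    .cons (.head (.head .id)) (.cons (.tail .id) (.tail (.head .id)))
  refine ⟨_, (hf.comp h₁).bind_cons (hf'.comp h₂), _, hη.add hη',
    fun n => add_nonneg (hη0 n) (hη0' n), fun n s => ?_⟩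
  simp only [head_cons, tail_cons, Pi.add_apply]
  rw [ENNReal.ofReal_add (hη0 n) (hη0' n)]
  exact (h n).bind fun d g hd => h' n d g s hd

theorem natCast_mul_ofReal (m : ℕ) (x : ℝ) :
    (m : ℝ≥0∞) * ENNReal.ofReal x = ENNReal.ofReal (m * x) := by
  rw [ENNReal.ofReal_mul (Nat.cast_nonneg m), ENNReal.ofReal_natCast]

/-! ### The distributions in the hybrid argument -/

variable (F)

/-- Independent random elements of the orbit of the origin. -/
noncomputable def orbitList (Q : Polynomial ℕ) (n : ℕ) : PMF BinTree :=
  (PMF.uniformOfFintype (Fin (Q.eval n) → F.G n)).bind fun g =>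
    PMF.pure (F.encList fun i => g i • F.origin n)

/-- Independent random set elements. -/
noncomputable def uniformList (Q : Polynomial ℕ) (n : ℕ) : PMF BinTree :=
  (PMF.uniformOfFintype (Fin (Q.eval n) → F.S n)).bind fun s => PMF.pure (F.encList s)

/-- Random elements of the orbits of independent random set elements `s i`, where the orbit of `s j`
is used from position `j` on. -/
noncomputable def hybridList (Q : Polynomial ℕ) (j n : ℕ) : PMF BinTree :=
  (PMF.uniformOfFintype (Fin (Q.eval n) → F.S n)).bind fun s =>
    (PMF.uniformOfFintype (Fin (Q.eval n) → F.G n)).bind fun h =>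
      PMF.pure (F.encList fun i => h i • s ⟨min i j, (min_le_left _ _).trans_lt i.2⟩)

/-- The first distribution of weak pseudorandomness. -/
noncomputable def actedPairs (Q : Polynomial ℕ) (n : ℕ) : PMF BinTree :=
  (PMF.uniformOfFintype (F.G n)).bind fun g =>
    (PMF.uniformOfFintype (Fin (Q.eval n) → F.S n)).bind fun s =>
      PMF.pure (F.encPairs s fun i => g • s i)

/-- The second distribution of weak pseudorandomness. -/
noncomputable def uniformPairs (Q : Polynomial ℕ) (n : ℕ) : PMF BinTree :=
  (PMF.uniformOfFintype (Fin (Q.eval n) → F.S n)).bind fun s =>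
    (PMF.uniformOfFintype (Fin (Q.eval n) → F.S n)).bind fun s' =>
      PMF.pure (F.encPairs s s')

/-- Pairs of elements of the same orbit. -/
noncomputable def orbitPairs (Q : Polynomial ℕ) (n : ℕ) : PMF BinTree :=
  (PMF.uniformOfFintype (Fin (Q.eval n) → F.S n)).bind fun s =>
    (PMF.uniformOfFintype (Fin (Q.eval n) → F.G n)).bind fun h =>
      PMF.pure (F.encPairs s fun i => h i • s i)

variable {F}

theorem bind_mul_right {G α : Type} [Group G] [Fintype G] {m : ℕ} (c : Fin m → G)
    (f : (Fin m → G) → PMF α) :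
    ((PMF.uniformOfFintype (Fin m → G)).bind fun h => f fun i => h i * c i) =
      (PMF.uniformOfFintype (Fin m → G)).bind f :=
  PMF.uniformOfFintype_bind_equiv (Equiv.piCongrRight fun i => Equiv.mulRight (c i)) f

/-- Each group element permutes all of S, so uniformity on S survives the action without
transitivity. -/
theorem bind_smul {G S α : Type} [Group G] [MulAction G S] [Fintype S] [Nonempty S] {m : ℕ}
    (c : Fin m → G) (f : (Fin m → S) → PMF α) :
    ((PMF.uniformOfFintype (Fin m → S)).bind fun s => f fun i => c i • s i) =
      (PMF.uniformOfFintype (Fin m → S)).bind f :=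
  PMF.uniformOfFintype_bind_equiv (Equiv.piCongrRight fun i => MulAction.toPerm (c i)) f

/-- Every position then has its own uniform base point, which absorbs the group element acting on
it. -/
theorem hybridList_of_le {Q : Polynomial ℕ} {j n : ℕ} (h : Q.eval n ≤ j) :
    F.hybridList Q j n = F.uniformList Q n := by
  have hmin : ∀ i : Fin (Q.eval n), min (i : ℕ) j = i := fun i => min_eq_left (i.2.le.trans h)
  simp only [hybridList, uniformList, hmin, Fin.eta]
  rw [PMF.bind_comm]
  simp only [bind_smul _ fun s : Fin (Q.eval n) → F.S n => PMF.pure (F.encList s),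
    PMF.bind_const]

theorem hybridList_zero (Q : Polynomial ℕ) (n : ℕ) : F.hybridList Q 0 n =
    (PMF.uniformOfFintype (F.S n)).bind fun u =>
      (PMF.uniformOfFintype (Fin (Q.eval n) → F.G n)).bind fun h =>
        PMF.pure (F.encList fun i => h i • u) := by
  unfold hybridList
  -- For Q = 0 there is no coordinate 0 to serve as common base point, but all lists are empty.
  rcases Nat.eq_zero_or_pos (Q.eval n) with h | h
  · have : IsEmpty (Fin (Q.eval n)) := by rw [h]; infer_instance
    have he : ∀ s : Fin (Q.eval n) → F.S n, F.encList s = BinTree.nil := fun s => by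
      rw [encList, List.ofFn_eq_nil_iff.2 h]
      rfl
    simp only [he, PMF.bind_const]
  · simp only [Nat.min_zero]
    exact PMF.uniformOfFintype_bind_eval (⟨0, h⟩ : Fin (Q.eval n)) fun u : F.S n =>
      (PMF.uniformOfFintype (Fin (Q.eval n) → F.G n)).bind fun h =>
        PMF.pure (F.encList fun i => h i • u)

/-- The hybrid distribution as it arises from pairs with the same group element. -/
theorem hybridList_eq_bind_smul (Q : Polynomial ℕ) (j n : ℕ) : F.hybridList Q j n =
    (PMF.uniformOfFintype (F.G n)).bind fun g =>
      (PMF.uniformOfFintype (Fin (Q.eval n) → F.S n)).bind fun s =>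
        (PMF.uniformOfFintype (Fin (Q.eval n) → F.G n)).bind fun h =>
          PMF.pure (F.encList fun i => h i • (if hij : (i : ℕ) ≤ j then s i
            else g • s ⟨j, (not_le.1 hij).trans i.2⟩)) := by
  rw [← PMF.bind_const (PMF.uniformOfFintype (F.G n)) (F.hybridList Q j n)]
  refine congrArg _ (funext fun g => ?_)
  unfold hybridList
  refine congrArg _ (funext fun s => ?_)
  -- For fixed g, replacing hᵢ by hᵢg at the positions i > j preserves the law of h.
  rw [← bind_mul_right fun i : Fin (Q.eval n) => if (i : ℕ) ≤ j then 1 else g]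
  refine congrArg _ (funext fun h => congrArg _ (congrArg _ (funext fun i => ?_)))
  by_cases hij : (i : ℕ) ≤ j
  · simp [hij]
  · simp [hij, mul_smul, min_eq_right (not_le.1 hij).le]

/-- The next hybrid distribution as it arises from independent pairs. -/
theorem hybridList_succ (Q : Polynomial ℕ) (j n : ℕ) : F.hybridList Q (j + 1) n =
    (PMF.uniformOfFintype (Fin (Q.eval n) → F.S n)).bind fun s =>
      (PMF.uniformOfFintype (Fin (Q.eval n) → F.S n)).bind fun s' =>
        (PMF.uniformOfFintype (Fin (Q.eval n) → F.G n)).bind fun h =>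
          PMF.pure (F.encList fun i => h i • (if hij : (i : ℕ) ≤ j then s i
            else s' ⟨j, (not_le.1 hij).trans i.2⟩)) := by
  unfold hybridList
  by_cases hj : j + 1 < Q.eval n
  · have heval : ∀ s : Fin (Q.eval n) → F.S n,
        ((PMF.uniformOfFintype (Fin (Q.eval n) → F.S n)).bind fun s' =>
          (PMF.uniformOfFintype (Fin (Q.eval n) → F.G n)).bind fun h =>
            PMF.pure (F.encList fun i => h i • (if hij : (i : ℕ) ≤ j then s i
              else s' ⟨j, (not_le.1 hij).trans i.2⟩))) =
        (PMF.uniformOfFintype (F.S n)).bind fun u =>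
          (PMF.uniformOfFintype (Fin (Q.eval n) → F.G n)).bind fun h =>
            PMF.pure (F.encList fun i => h i • (if (i : ℕ) ≤ j then s i else u)) := by
      intro s
      exact PMF.uniformOfFintype_bind_eval (⟨j, by omega⟩ : Fin (Q.eval n)) fun u : F.S n =>
        (PMF.uniformOfFintype (Fin (Q.eval n) → F.G n)).bind fun h =>
          PMF.pure (F.encList fun i => h i • (if (i : ℕ) ≤ j then s i else u))
    simp only [heval]
    -- Beyond position j only the fresh element u = s'ⱼ is used, so it can take the place of the
    -- coordinate j + 1 of s.
    rw [← PMF.uniformOfFintype_bind_update_self (⟨j + 1, hj⟩ : Fin (Q.eval n))]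
    refine congrArg _ (funext fun s => congrArg _ (funext fun u => congrArg _ (funext fun h =>
      congrArg _ (congrArg _ (funext fun i => ?_)))))
    by_cases hij : (i : ℕ) ≤ j
    · have hmin : (⟨min i (j + 1), (min_le_left _ _).trans_lt i.2⟩ : Fin (Q.eval n)) = i :=
        Fin.ext (min_eq_left (by omega))
      rw [hmin, Function.update_of_ne (by rintro rfl; simp at hij), if_pos hij]
    · have hmin : (⟨min i (j + 1), (min_le_left _ _).trans_lt i.2⟩ : Fin (Q.eval n)) =
          ⟨j + 1, hj⟩ := Fin.ext (min_eq_right (by omega))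
      rw [hmin, Function.update_self, if_neg hij]
  -- No position lies beyond j: both sides use every sᵢ at its own position.
  · have hle : ∀ i : Fin (Q.eval n), (i : ℕ) ≤ j := fun i => by omega
    have hmin : ∀ i : Fin (Q.eval n), min (i : ℕ) (j + 1) = i := fun i =>
      min_eq_left ((hle i).trans j.le_succ)
    simp only [hle, hmin, dif_pos, Fin.eta, PMF.bind_const]

/-! ### The reductions -/

/-- A single pseudorandomness sample (s₀, t) suffices: the reduction outputs Q random elements of
the orbit of t. For t = g ⋆ s₀ the independent hᵢ absorb g. -/
theorem orbitList_indist_hybridList_zero (hE : F.IsEffective) (hp : F.Pseudorandom)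
    (Q : Polynomial ℕ) : CompIndist (F.orbitList Q) (F.hybridList Q 0) := by
  obtain ⟨f, hf, η, hη, hη0, h⟩ := hE.exists_orbitSampler
  -- The mapped list is `unary Q`, which only counts repetitions; the sampler reads the parameter
  -- alone.
  have hmap := (hf.comp (EfficientFun.id.head)).mapM
    (.cons (.head .id) (.tail (.tail .id))) (EfficientFun.unary_eval Q (.head .id))
  have key : ∀ n (s t : F.S n), ApproxCouple (ENNReal.ofReal ((Q.eval n : ℕ) * η n)) Eq
      (mapM (fun y => f y.head) (cons (unary n) (F.enc t))
        (unary (Q.eval (unary n).length)))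
      ((PMF.uniformOfFintype (Fin (Q.eval n) → F.G n)).bind fun h =>
        PMF.pure (F.encList fun i => h i • t)) := by
    intro n s t
    have hu : unary (Q.eval n) = ofList (List.ofFn fun _ : Fin (Q.eval n) => nil) := by
      rw [unary, List.ofFn_const]
    rw [← natCast_mul_ofReal, length_unary, hu]
    exact approxCouple_mapM (f := fun y => f y.head) (φ := fun _ g => F.enc (g • t)) fun i => h n t
  refine CompIndist.map hp hmap (hη.polynomial_mul Q)
    (fun n => mul_nonneg (Nat.cast_nonneg _) (hη0 n)) (fun n => ?_) fun n => ?_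
  · have hD : F.orbitList Q n = (PMF.uniformOfFintype (F.G n)).bind fun g =>
        (PMF.uniformOfFintype (Fin (Q.eval n) → F.G n)).bind fun h =>
          PMF.pure (F.encList fun i => h i • g • F.origin n) := by
      simp only [smul_smul, bind_mul_right _ fun h : Fin (Q.eval n) → F.G n =>
        PMF.pure (F.encList fun i => h i • F.origin n), PMF.bind_const]
      rfl
    rw [hD, PMF.bind_bind]
    refine ApproxCouple.bind_right _ fun g => ?_
    simpa only [PMF.pure_bind, encPair, head_cons, tail_cons] using
      key n (F.origin n) (g • F.origin n)
  · rw [hybridList_zero, PMF.bind_bind]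
    refine ApproxCouple.bind_right _ fun u => ?_
    simpa only [PMF.pure_bind, encPair, head_cons, tail_cons] using key n (F.origin n) u

/-- Two consecutive hybrid distributions at a random position. -/
theorem bind_hybridList_indist (hE : F.IsEffective) (hw : F.WeaklyPseudorandom)
    (Q : Polynomial ℕ) : CompIndist
      (fun n => (randomIndex (Nat.clog 2 (Q.eval n))).bind fun j => F.hybridList Q j n)
      (fun n => (randomIndex (Nat.clog 2 (Q.eval n))).bind fun j =>
        F.hybridList Q (j + 1) n) := by
  obtain ⟨f, hf, η, hη, hη0, h⟩ := hE.exists_orbitSampler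
  -- One uniform reduction must serve all hybrids: it chooses the position at random, splices the
  -- pairs there and moves every entry to a random point of its orbit.
  have hmap := (Efficient.randomSuffix (.tail .id)).bind_cons (hf.mapM (.head (.head .id))
    (EfficientFun.splice (.head (.tail .id)) (.tail (.head .id))))
  simp only [head_cons, tail_cons] at hmap
  have key : ∀ n (s t : Fin (Q.eval n) → F.S n),
      ApproxCouple (ENNReal.ofReal ((Q.eval n : ℕ) * η n)) Eq
        ((randomSuffix (F.encPairs s t)).bind fun y =>
          mapM f (unary n) (splice y.head (F.encPairs s t)))
        ((randomIndex (Nat.clog 2 (Q.eval n))).bind fun j =>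
          (PMF.uniformOfFintype (Fin (Q.eval n) → F.G n)).bind fun h =>
            PMF.pure (F.encList fun i => h i • (if hij : (i : ℕ) ≤ j then s i
              else t ⟨j, (not_le.1 hij).trans i.2⟩))) := by
    intro n s t
    obtain ⟨r, hr⟩ := randomSuffix_eq (F.encPairs s t)
    have hlen : (F.encPairs s t).length = Q.eval n := by
      rw [encPairs, length_ofList, List.length_ofFn]
    rw [hr, hlen, PMF.bind_bind]
    refine ApproxCouple.bind_right _ fun j => ?_
    rw [PMF.pure_bind, head_cons, ← natCast_mul_ofReal]
    unfold encPairs encPair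
    rw [splice_tail_iterate]
    refine approxCouple_mapM (φ := fun i g => F.enc (g • (if hij : (i : ℕ) ≤ j then s i
      else t ⟨j, (not_le.1 hij).trans i.2⟩))) fun i => ?_
    split_ifs
    · exact h n _
    · exact h n _
  refine CompIndist.map (hw Q) hmap (hη.polynomial_mul Q)
    (fun n => mul_nonneg (Nat.cast_nonneg _) (hη0 n)) (fun n => ?_) fun n => ?_
  · simp only [hybridList_eq_bind_smul, PMF.bind_bind, PMF.pure_bind, head_cons, tail_cons]
    rw [PMF.bind_comm (randomIndex _)]
    refine ApproxCouple.bind_right _ fun g => ?_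
    rw [PMF.bind_comm (randomIndex _)]
    exact ApproxCouple.bind_right _ fun s => key n s _
  · simp only [hybridList_succ, PMF.bind_bind, PMF.pure_bind, head_cons, tail_cons]
    rw [PMF.bind_comm (randomIndex _)]
    refine ApproxCouple.bind_right _ fun s => ?_
    rw [PMF.bind_comm (randomIndex _)]
    exact ApproxCouple.bind_right _ fun s' => key n s s'

/-- At a random position the advantage is the telescoped difference of hybrids 0 and 2 ^ k, divided
by 2 ^ k. As 2 ^ k ≥ Q, the last hybrid is the uniform list. -/
theorem hybridList_zero_indist_uniformList (hE : F.IsEffective) (hw : F.WeaklyPseudorandom)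
    (Q : Polynomial ℕ) : CompIndist (F.hybridList Q 0) (F.uniformList Q) := by
  intro A
  refine Negligible.of_le ((bind_hybridList_indist hE hw Q A).polynomial_mul (2 * Q + 1))
    (fun _ => abs_nonneg _) fun n => ?_
  set k := Nat.clog 2 (Q.eval n) with hk
  have hQk : Q.eval n ≤ 2 ^ k := Nat.le_pow_clog Nat.one_lt_two _
  -- The summand 1 covers Q = 0, where 2 ^ k = 1.
  have hkQ : 2 ^ k ≤ 2 * Q.eval n + 1 := by
    rcases Nat.eq_zero_or_pos k with h | h
    · simp [h]
    · have h₁ : 2 ^ (k - 1) < Q.eval n := Nat.pow_lt_of_lt_clog (by omega)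
      have h₂ : 2 ^ k = 2 * 2 ^ (k - 1) := by rw [← pow_succ', Nat.sub_add_cancel h]
      omega
  set P : ℕ → ℝ := fun j => prob ((F.hybridList Q j n).bind (A.run n)) {BinTree.ofBool true}
    with hP
  rw [← hybridList_of_le hQk]
  simp only [PMF.bind_bind, prob_bind_randomIndex, ← sub_div, ← Finset.sum_sub_distrib]
  change |P 0 - P (2 ^ k)| ≤ _ * |(∑ j ∈ Finset.range (2 ^ k), (P j - P (j + 1))) / 2 ^ k|
  have hpos : (0 : ℝ) < 2 ^ k := by positivity
  rw [Finset.sum_range_sub', abs_div, abs_of_pos hpos, mul_div_assoc', le_div_iff₀ hpos,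
    mul_comm]
  refine mul_le_mul_of_nonneg_right ?_ (abs_nonneg _)
  have : (2 * Q + 1).eval n = 2 * Q.eval n + 1 := by simp
  rw [this]
  exact_mod_cast hkQ

theorem orbitList_indist_uniformList (hE : F.IsEffective) (hw : F.WeaklyPseudorandom)
    (hp : F.Pseudorandom) (Q : Polynomial ℕ) : CompIndist (F.orbitList Q) (F.uniformList Q) :=
  (orbitList_indist_hybridList_zero hE hp Q).trans (hybridList_zero_indist_uniformList hE hw Q)

/-- Replace every element of a list by the pair of the element and its image under the same random
group element. -/
theorem indist_actedPairs (hE : F.IsEffective) (hw : F.WeaklyPseudorandom)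
    (hp : F.Pseudorandom) (Q : Polynomial ℕ) : CompIndist
      (fun n => (PMF.uniformOfFintype (F.G n)).bind fun g' =>
        (PMF.uniformOfFintype (Fin (Q.eval n) → F.G n)).bind fun g =>
          PMF.pure (F.encPairs (fun i => g i • F.origin n) fun i => (g' * g i) • F.origin n))
      (F.actedPairs Q) := by
  obtain ⟨f, hf, η, hη, hη0, h⟩ := hE.exists_sampler
  obtain ⟨f', hf', η', hη', hη0', h'⟩ := hE.exists_act
  have h₁ : EfficientFun fun x => cons x.head nil := .cons (.head .id) .nil
  have h₂ : EfficientFun fun x => cons x.head.head (cons x.head.tail x.tail) :=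
    .cons (.head (.head .id)) (.cons (.tail (.head .id)) (.tail .id))
  have h₃ : EfficientFun fun x => cons x.head.tail x.tail :=
    .cons (.tail (.head .id)) (.tail .id)
  have hmap := (hf.comp h₁).bind_cons (((hf'.comp h₂).bind_cons h₃).mapM
    (.cons (.head (.head .id)) (.tail .id)) (.tail (.head .id)))
  simp only [head_cons, tail_cons] at hmap
  have key : ∀ n (s : Fin (Q.eval n) → F.S n),
      ApproxCouple (ENNReal.ofReal (η n + (Q.eval n : ℕ) * η' n)) Eq
        ((f (cons (unary n) nil)).bind fun z =>
          mapM (fun x => (f' (cons x.head.head (cons x.head.tail x.tail))).bind fun y =>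
            PMF.pure (cons x.tail y)) (cons (unary n) z) (F.encList s))
        ((PMF.uniformOfFintype (F.G n)).bind fun g =>
          PMF.pure (F.encPairs s fun i => g • s i)) := by
    intro n s
    rw [ENNReal.ofReal_add (hη0 n) (mul_nonneg (Nat.cast_nonneg _) (hη0' n)),
      ← natCast_mul_ofReal]
    refine (h n).bind fun z g hz => approxCouple_mapM_pure fun i => ?_
    simpa only [encPair, head_cons, tail_cons, PMF.pure_bind] using
      (h' n z g (s i) hz).bind_left fun y => PMF.pure (cons (F.enc (s i)) y)
  refine CompIndist.map (orbitList_indist_uniformList hE hw hp Q) hmap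
    (hη.add (hη'.polynomial_mul Q))
    (fun n => add_nonneg (hη0 n) (mul_nonneg (Nat.cast_nonneg _) (hη0' n)))
    (fun n => ?_) fun n => ?_
  · simp only [orbitList, PMF.bind_bind, PMF.pure_bind, head_cons, tail_cons, mul_smul]
    rw [PMF.bind_comm (PMF.uniformOfFintype (F.G n))]
    exact ApproxCouple.bind_right _ fun g => key n _
  · simp only [uniformList, actedPairs, PMF.bind_bind, PMF.pure_bind, head_cons, tail_cons]
    rw [PMF.bind_comm (PMF.uniformOfFintype (F.G n))]
    exact ApproxCouple.bind_right _ fun s => key n s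

/-- Replace every element of a list by the pair of the element and a random element of its orbit. -/
theorem indist_orbitPairs (hE : F.IsEffective) (hw : F.WeaklyPseudorandom)
    (hp : F.Pseudorandom) (Q : Polynomial ℕ) : CompIndist
      (fun n => (PMF.uniformOfFintype (Fin (Q.eval n) → F.G n)).bind fun g =>
        (PMF.uniformOfFintype (Fin (Q.eval n) → F.G n)).bind fun h =>
          PMF.pure (F.encPairs (fun i => g i • F.origin n) fun i => h i • F.origin n))
      (F.orbitPairs Q) := by
  obtain ⟨f, hf, η, hη, hη0, h⟩ := hE.exists_orbitSampler
  have h₁ : EfficientFun fun x => cons x.head.tail x.tail :=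
    .cons (.tail (.head .id)) (.tail .id)
  have hmap := (hf.bind_cons h₁).mapM (.head .id) (.tail .id)
  have key : ∀ n (s : Fin (Q.eval n) → F.S n),
      ApproxCouple (ENNReal.ofReal ((Q.eval n : ℕ) * η n)) Eq
        (mapM (fun x => (f x).bind fun y => PMF.pure (cons (cons x y).head.tail (cons x y).tail))
          (unary n) (F.encList s))
        ((PMF.uniformOfFintype (Fin (Q.eval n) → F.G n)).bind fun h =>
          PMF.pure (F.encPairs s fun i => h i • s i)) := by
    intro n s
    rw [← natCast_mul_ofReal]
    refine approxCouple_mapM (φ := fun i g => F.encPair (s i) (g • s i)) fun i => ?_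
    simpa only [encPair, head_cons, tail_cons, PMF.bind_bind, PMF.pure_bind] using
      (h n (s i)).bind_left fun y => PMF.pure (cons (F.enc (s i)) y)
  refine CompIndist.map (orbitList_indist_uniformList hE hw hp Q) hmap (hη.polynomial_mul Q)
    (fun n => mul_nonneg (Nat.cast_nonneg _) (hη0 n)) (fun n => ?_) fun n => ?_
  -- For fixed g, the products hᵢgᵢ are again independent and uniform, so the second components may
  -- be taken as images of the first.
  · have hG : ∀ g : Fin (Q.eval n) → F.G n,
        ((PMF.uniformOfFintype (Fin (Q.eval n) → F.G n)).bind fun h =>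
          PMF.pure (F.encPairs (fun i => g i • F.origin n) fun i => h i • F.origin n)) =
        (PMF.uniformOfFintype (Fin (Q.eval n) → F.G n)).bind fun h =>
          PMF.pure (F.encPairs (fun i => g i • F.origin n) fun i => h i • g i • F.origin n) := by
      intro g
      simp only [smul_smul, bind_mul_right g fun h : Fin (Q.eval n) → F.G n =>
        PMF.pure (F.encPairs (fun i => g i • F.origin n) fun i => h i • F.origin n)]
    simp only [orbitList, PMF.bind_bind, PMF.pure_bind, hG]
    exact ApproxCouple.bind_right _ fun g => key n _
  · simp only [uniformList, PMF.bind_bind, PMF.pure_bind]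
    exact ApproxCouple.bind_right _ fun s => key n s

/-- Replace the second component of every pair by a random element of its orbit. -/
theorem orbitPairs_indist_uniformPairs (hE : F.IsEffective) (hw : F.WeaklyPseudorandom)
    (Q : Polynomial ℕ) : CompIndist (F.orbitPairs Q) (F.uniformPairs Q) := by
  obtain ⟨f, hf, η, hη, hη0, h⟩ := hE.exists_orbitSampler
  have h₁ : EfficientFun fun x => cons x.head x.tail.tail := .cons (.head .id) (.tail (.tail .id))
  have h₂ : EfficientFun fun x => cons x.head.tail.head x.tail :=
    .cons (.head (.tail (.head .id))) (.tail .id)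
  have hmap := ((hf.comp h₁).bind_cons h₂).mapM (.head .id) (.tail .id)
  have key : ∀ n (s t : Fin (Q.eval n) → F.S n),
      ApproxCouple (ENNReal.ofReal ((Q.eval n : ℕ) * η n)) Eq
        (mapM (fun x => (f (cons x.head x.tail.tail)).bind fun y =>
          PMF.pure (cons (cons x y).head.tail.head (cons x y).tail))
          (unary n) (F.encPairs s t))
        ((PMF.uniformOfFintype (Fin (Q.eval n) → F.G n)).bind fun h =>
          PMF.pure (F.encPairs s fun i => h i • t i)) := by
    intro n s t
    rw [← natCast_mul_ofReal]
    refine approxCouple_mapM (φ := fun i g => F.encPair (s i) (g • t i)) fun i => ?_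
    simpa only [encPair, head_cons, tail_cons, PMF.bind_bind, PMF.pure_bind] using
      (h n (t i)).bind_left fun y => PMF.pure (cons (F.enc (s i)) y)
  refine CompIndist.map (hw Q) hmap (hη.polynomial_mul Q)
    (fun n => mul_nonneg (Nat.cast_nonneg _) (hη0 n)) (fun n => ?_) fun n => ?_
  -- A dummy g is drawn so that both sides can be compared for each g; the hᵢ then absorb it.
  · rw [← PMF.bind_const (PMF.uniformOfFintype (F.G n)) (F.orbitPairs Q n)]
    rw [PMF.bind_bind]
    refine ApproxCouple.bind_right _ fun g => ?_
    unfold orbitPairs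
    rw [PMF.bind_bind]
    refine ApproxCouple.bind_right _ fun s => ?_
    rw [PMF.pure_bind, ← bind_mul_right fun _ => g]
    simpa only [mul_smul, head_cons, tail_cons] using key n s fun i => g • s i
  · unfold uniformPairs
    rw [PMF.bind_bind]
    refine ApproxCouple.bind_right _ fun s => ?_
    -- Independent uniform s'ᵢ are unaffected by rerandomization within orbits.
    have hS : ((PMF.uniformOfFintype (Fin (Q.eval n) → F.S n)).bind fun s' =>
          PMF.pure (F.encPairs s s')) =
        (PMF.uniformOfFintype (Fin (Q.eval n) → F.S n)).bind fun s' =>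
          (PMF.uniformOfFintype (Fin (Q.eval n) → F.G n)).bind fun h =>
            PMF.pure (F.encPairs s fun i => h i • s' i) := by
      rw [PMF.bind_comm]
      simp only [bind_smul _ fun s' : Fin (Q.eval n) → F.S n => PMF.pure (F.encPairs s s'),
        PMF.bind_const]
    rw [PMF.bind_bind, hS]
    refine ApproxCouple.bind_right _ fun s' => ?_
    rw [PMF.pure_bind]
    exact key n s s'

end GroupActionFamily

/-! ### Both Naor–Reingold distributions meet in the uniform pairs -/

theorem lemmaB3 (F : GroupActionFamily) (hE : F.IsEffective)
    (hw : F.WeaklyPseudorandom) (hp : F.Pseudorandom) : F.NaorReingold := by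
  intro Q
  exact ((GroupActionFamily.indist_actedPairs hE hw hp Q).trans (hw Q)).trans
    ((GroupActionFamily.indist_orbitPairs hE hw hp Q).trans
      (GroupActionFamily.orbitPairs_indist_uniformPairs hE hw Q)).symm
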